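/- Let $d\ge 1$, let $L$ be a positive multiple of $4$, let $\Lambda=(\mathbb Z/L\mathbb Z)^d$ with dual lattice $\Lambda^*=\frac{2\pi}{L}(\mathbb Z/L\mathbb Z)^d$, and let $g>0$. On $\mathfrak h=\ell^2(\Lambda\times\{\uparrow,\downarrow\})=\ell^2(\Lambda)\otimes\mathbb C^2$ consider the Hubbard Hamiltonian $\mathbb T+\frac g2\mathbb V$, where $\mathbb T=\sum_{x,y\in\Lambda}\sum_\sigma t_{x-y}\,c^*_{x,\sigma}c_{y,\sigma}$, $\mathbb V=2\sum_{x\in\Lambda} c^*_{x,\uparrow}c^*_{x,\downarrow}c_{x,\downarrow}c_{x,\uparrow}$, and $t_z=-1$ if $z$ is at $\ell^1$-distance $1$ from $0$ on the torus, $t_z=0$ otherwise. Let $T=(t_{x-y})_{x,y\in\Lambda}$ be the hopping matrix, let $\omega_\xi=\sum_{z\in\Lambda}e^{-i\xi\cdot z}t_z=-2\sum_{\nu=1}^d\cos\xi_\nu$ for $\xi\in\Lambda^*$, let $G$ be the operator of multiplication by $(-1)^{x_1+\dots+x_d}$ on $\ell^2(\Lambda)$, and let $\vec\sigma$ be the vector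 of Pauli matrices. For self-adjoint $\gamma$ on $\mathfrak h$ with $0\le\gamma\le 1$, the Hartree–Fock functional of this Hamiltonian is $$\mathcal E_{HF}(\gamma)=\mathrm{Tr}[(T\otimes 1)\gamma]+\frac g2\sum_{x\in\Lambda}\Big\{[\mathrm{Tr}_{\mathbb C^2}\gamma_x]^2-\mathrm{Tr}_{\mathbb C^2}(\gamma_x^2)\Big\},\qquad \gamma_x(\sigma,\tau)=\langle\delta_{x,\sigma}|\gamma\,\delta_{x,\tau}\rangle ,$$ and the Hartree–Fock energy at half-filling is $E_{HF}(|\Lambda|)=\inf\{\mathcal E_{HF}(\gamma): 0\le\gamma\le 1,\ \mathrm{Tr}\,\gamma=|\Lambda|\}$. A Hartree–Fock ground state is a $\gamma$ with $0\le\gamma\le1$, $\mathrm{Tr}\,\gamma=|\Lambda|$ and $\mathcal E_{HF}(\gamma)=E_{HF}(|\Lambda|)$. Then the gap equation $$2=\frac1{|\Lambda^*|}\sum_{\xi\in\Lambda^*}g\,(\omega_\xi^2+g^2\Delta^2)^{-1/2}$$ has exactly one solution $\Delta\in(0,\infty)$; it satisfies $\Delta\in(0,\frac12)$, and the following holds.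 (i) The Hartree–Fock energy per site is $$\frac{E_{HF}(|\Lambda|)}{|\Lambda|}=\frac g4+g\Delta^2-\frac1{|\Lambda^*|}\sum_{\xi\in\Lambda^*}\sqrt{\omega_\xi^2+g^2\Delta^2}.$$ (ii) A $\gamma$ with $0\le\gamma\le1$ and $\mathrm{Tr}\,\gamma=|\Lambda|$ is a Hartree–Fock ground state if and only if there is a unit vector $\vec e\in\mathbb R^3$ such that $$\gamma=\mathbf 1\big[\,T\otimes 1-g\Delta\,G\otimes(\vec e\cdot\vec\sigma)\le 0\,\big].$$ -/

import Mathlib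

open scoped Kronecker

noncomputable section

namespace Hubbard

open scoped ComplexOrder

/-- The discrete torus `(ℤ / L ℤ)^d`. The dual lattice `(2π / L) (ℤ / L ℤ)^d` is labelled by the
same index set: `k` stands for the momentum `ξ = 2π k / L`. -/
abbrev Lattice (d L : ℕ) : Type := Fin d → ZMod L

/-- The distance of `z` to the origin of the torus: the minimum of the `ℓ¹` norm over all integer
representatives of `z`. -/
def torusNorm {d L : ℕ} (z : Lattice d L) : ℕ := ∑ ν, (z ν).valMinAbs.natAbs

/-- The nearest-neighbour hopping amplitude `t_z = - 1(|z| = 1)`. -/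
def hopping {d L : ℕ} (z : Lattice d L) : ℝ := if torusNorm z = 1 then -1 else 0

/-- The hopping matrix `T = (t_{x - y})_{x, y}` on `ℓ²(Λ)`. -/
def hoppingMatrix (d L : ℕ) : Matrix (Lattice d L) (Lattice d L) ℂ :=
  Matrix.of fun x y => (hopping (x - y) : ℂ)

/-- The number `ξ · z` for the momentum `ξ = 2π k / L` (determined modulo `2π` by `k` and `z`;
representatives in `{0, …, L - 1}` are used). -/
def phase {d L : ℕ} (k z : Lattice d L) : ℝ :=
  ∑ ν, 2 * Real.pi * ((k ν).val : ℝ) / (L : ℝ) * ((z ν).val : ℝ)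

/-- The Fourier transform `∑_z exp(-i ξ·z) t_z` of the hopping amplitude. -/
def hoppingFourier {d L : ℕ} [NeZero L] (k : Lattice d L) : ℂ :=
  ∑ z : Lattice d L, Complex.exp (-(Complex.I * (phase k z : ℂ))) * (hopping z : ℂ)

/-- The dispersion relation `ω_ξ`, the (real) Fourier transform of the hopping amplitude. -/
def dispersion {d L : ℕ} [NeZero L] (k : Lattice d L) : ℝ := (hoppingFourier k).re

/-- The staggering sign `(-1)^x = (-1)^{x_1} ⋯ (-1)^{x_d}` (well defined for even `L`). -/
def staggerSign {d L : ℕ} (x : Lattice d L) : ℂ := ∏ ν, (-1 : ℂ) ^ (x ν).val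

/-- The gauge transformation `G`, multiplication by `(-1)^x`. -/
def gauge (d L : ℕ) : Matrix (Lattice d L) (Lattice d L) ℂ := Matrix.diagonal staggerSign

/-- The three Pauli matrices. -/
def pauli : Fin 3 → Matrix (Fin 2) (Fin 2) ℂ :=
  ![!![0, 1; 1, 0], !![0, -Complex.I; Complex.I, 0], !![1, 0; 0, -1]]

/-- `e · σ` for a real three-vector `e`. -/
def pauliDot (e : EuclideanSpace ℝ (Fin 3)) : Matrix (Fin 2) (Fin 2) ℂ :=
  ∑ j, (e j : ℂ) • pauli j

/-- Labels `(x, σ)` of the canonical basis of `𝔥 = ℓ²(Λ × {↑, ↓}) = ℓ²(Λ) ⊗ ℂ²`; operators on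
`𝔥` are matrices over this index set. -/
abbrev Orbital (d L : ℕ) : Type := Lattice d L × Fin 2

/-- The exchange operator `Ex (f ⊗ g) = g ⊗ f` on `𝔥 ⊗ 𝔥`. -/
def exchange (ι : Type*) [DecidableEq ι] : Matrix (ι × ι) (ι × ι) ℂ :=
  Matrix.of fun p q => if p = q.swap then 1 else 0

/-- The Hartree–Fock functional of the Hamiltonian `𝕋 + (κ/2) 𝕍` with one-body operator `t` and
pair interaction `v`:
`Tr[t γ] + (κ/2) Tr_{𝔥 ⊗ 𝔥}[v (1 - Ex) (γ ⊗ γ)]` (a real number for self-adjoint `t`, `v`, `γ`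
with `v` commuting with the exchange). -/
def hfFunctional {ι : Type*} [Fintype ι] [DecidableEq ι] (κ : ℝ) (t : Matrix ι ι ℂ)
    (v : Matrix (ι × ι) (ι × ι) ℂ) (γ : Matrix ι ι ℂ) : ℝ :=
  (t * γ).trace.re + κ / 2 * (v * (1 - exchange ι) * (γ ⊗ₖ γ)).trace.re

/-- The on-site repulsion `v_{x-y} = δ_{x,y}`, as a multiplication operator on `𝔥 ⊗ 𝔥`. -/
def onSite (d L : ℕ) : Matrix (Orbital d L × Orbital d L) (Orbital d L × Orbital d L) ℂ :=
  Matrix.diagonal fun p => if p.1.1 = p.2.1 then 1 else 0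

/-- The Hartree–Fock functional of the Hubbard Hamiltonian `𝕋 + (g/2) 𝕍`, where
`𝕍 = 2 ∑_x c*_{x↑} c*_{x↓} c_{x↓} c_{x↑}` is the second quantization of the on-site repulsion. -/
def energy {d L : ℕ} [NeZero L] (g : ℝ) (γ : Matrix (Orbital d L) (Orbital d L) ℂ) : ℝ :=
  hfFunctional g (hoppingMatrix d L ⊗ₖ (1 : Matrix (Fin 2) (Fin 2) ℂ)) (onSite d L) γ

/-- The same functional in coordinates: the interaction part is
`(g/2) ∑_{x,σ,τ} {γ_x(σ,σ) γ_x(τ,τ) - γ_x(σ,τ) γ_x(τ,σ)}`. -/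
theorem energy_eq {d L : ℕ} [NeZero L] (g : ℝ) (γ : Matrix (Orbital d L) (Orbital d L) ℂ) :
    energy g γ =
      ((hoppingMatrix d L ⊗ₖ (1 : Matrix (Fin 2) (Fin 2) ℂ)) * γ).trace.re +
        g / 2 * (∑ x : Lattice d L, ∑ σ : Fin 2, ∑ τ : Fin 2,
          (γ (x, σ) (x, σ) * γ (x, τ) (x, τ) - γ (x, σ) (x, τ) * γ (x, τ) (x, σ))).re := by
  have h : (onSite d L * (1 - exchange (Orbital d L)) * (γ ⊗ₖ γ)).trace =
      ∑ x : Lattice d L, ∑ σ : Fin 2, ∑ τ : Fin 2,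
          (γ (x, σ) (x, σ) * γ (x, τ) (x, τ) - γ (x, σ) (x, τ) * γ (x, τ) (x, σ)) := by
    have hE : ∀ p : Orbital d L × Orbital d L,
        ((1 - exchange (Orbital d L)) * (γ ⊗ₖ γ)) p p =
          γ p.1 p.1 * γ p.2 p.2 - γ p.1 p.2 * γ p.2 p.1 := by
      intro p
      have h2 : (exchange (Orbital d L) * (γ ⊗ₖ γ)) p p = γ p.1 p.2 * γ p.2 p.1 := by
        have h3 : ∀ q : Orbital d L × Orbital d L, (p = q.swap) = (q = p.swap) := by
          intro q
          exact propext ⟨fun h => by rw [h, Prod.swap_swap], fun h => by rw [h, Prod.swap_swap]⟩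
        simp only [Matrix.mul_apply, exchange, Matrix.of_apply, h3]
        simp [mul_comm]
      rw [Matrix.sub_mul, Matrix.sub_apply, h2, Matrix.one_mul]
      simp
    simp only [Matrix.trace, Matrix.diag_apply, Matrix.mul_assoc, onSite, Matrix.diagonal_mul, hE]
    simp only [Fintype.sum_prod_type, ite_mul, one_mul, zero_mul]
    refine Finset.sum_congr rfl fun x _ => Finset.sum_congr rfl fun σ _ => ?_
    rw [Finset.sum_comm]
    simp
  rw [energy, hfFunctional, h]

/-- One-particle density matrices `0 ≤ γ ≤ 1` with particle number `Tr γ = N`. -/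
structure IsDensityMatrix {ι : Type*} [Fintype ι] [DecidableEq ι] (N : ℕ)
    (γ : Matrix ι ι ℂ) : Prop where
  nonneg : γ.PosSemidef
  le_one : (1 - γ).PosSemidef
  trace_eq : γ.trace = (N : ℂ)

/-- The Hartree–Fock energy for `N` electrons. -/
def hfEnergy (d L : ℕ) [NeZero L] (g : ℝ) (N : ℕ) : ℝ :=
  sInf {E : ℝ | ∃ γ : Matrix (Orbital d L) (Orbital d L) ℂ,
    IsDensityMatrix N γ ∧ energy g γ = E}

/-- `γ` is a Hartree–Fock ground state for `N` electrons. -/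
def IsHFGroundState {d L : ℕ} [NeZero L] (g : ℝ) (N : ℕ)
    (γ : Matrix (Orbital d L) (Orbital d L) ℂ) : Prop :=
  IsDensityMatrix N γ ∧ energy g γ = hfEnergy d L g N

/-- The average `|Λ*|⁻¹ ∑_{ξ ∈ Λ*} f_ξ` over the dual lattice. -/
def momentumAverage {d L : ℕ} [NeZero L] (f : Lattice d L → ℝ) : ℝ :=
  (Fintype.card (Lattice d L) : ℝ)⁻¹ * ∑ k, f k

/-- The gap equation `2 = |Λ*|⁻¹ ∑_ξ g (ω_ξ² + g² Δ²)^{-1/2}`. -/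
def GapEquation (d L : ℕ) [NeZero L] (g Δ : ℝ) : Prop :=
  2 = momentumAverage fun k : Lattice d L =>
    g * (dispersion k ^ 2 + g ^ 2 * Δ ^ 2) ^ (-(1 / 2) : ℝ)

/-- The mean-field operator `T ⊗ 1 - r G ⊗ (e · σ)`. -/
def meanField (d L : ℕ) (r : ℝ) (e : EuclideanSpace ℝ (Fin 3)) :
    Matrix (Orbital d L) (Orbital d L) ℂ :=
  hoppingMatrix d L ⊗ₖ (1 : Matrix (Fin 2) (Fin 2) ℂ) - (r : ℂ) • (gauge d L ⊗ₖ pauliDot e)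

/-- The spectral projection `1[A ≤ 0]` of a self-adjoint matrix `A`. -/
def nonposProjection {ι : Type*} [Fintype ι] [DecidableEq ι] (A : Matrix ι ι ℂ) :
    Matrix ι ι ℂ :=
  cfc (fun s : ℝ => if s ≤ 0 then (1 : ℝ) else 0) A

theorem torusNorm_neg {d L : ℕ} (z : Lattice d L) : torusNorm (-z) = torusNorm z := by
  simp [torusNorm]

theorem pauliDot_isHermitian (e : EuclideanSpace ℝ (Fin 3)) : (pauliDot e).IsHermitian := by
  ext i j
  fin_cases i <;> fin_cases j <;> simp [pauliDot, pauli, Fin.sum_univ_three]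

/-- The operator whose spectral projection is taken is self-adjoint. -/
theorem meanField_isHermitian (d L : ℕ) (r : ℝ) (e : EuclideanSpace ℝ (Fin 3)) :
    (meanField d L r e).IsHermitian := by
  have hT : (hoppingMatrix d L).IsHermitian := by
    ext x y
    have h : hopping (y - x) = hopping (x - y) := by
      rw [hopping, hopping, ← neg_sub x y, torusNorm_neg]
    simp [hoppingMatrix, h]
  have hG : (gauge d L).IsHermitian := by
    refine Matrix.isHermitian_diagonal_of_self_adjoint _ ?_
    ext x
    simp [staggerSign]
  rw [Matrix.IsHermitian, meanField, Matrix.conjTranspose_sub, Matrix.conjTranspose_smul,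
    Matrix.conjTranspose_kronecker, Matrix.conjTranspose_kronecker, hT.eq, hG.eq,
    (pauliDot_isHermitian e).eq, Matrix.conjTranspose_one]
  simp

/-- The sites at distance one from the origin are the `2d` nearest neighbours. -/
theorem torusNorm_eq_one_iff {d L : ℕ} [NeZero L] (hL : 3 ≤ L) (z : Lattice d L) :
    torusNorm z = 1 ↔ ∃ ν, z = Pi.single ν 1 ∨ z = Pi.single ν (-1) := by
  have : Fact (1 < L) := ⟨by omega⟩
  have h1 : ((1:ZMod L)).valMinAbs = 1 := by
    rw [ZMod.valMinAbs_def_pos, ZMod.val_one]; simp; omega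
  have h1' : ((-1:ZMod L)).valMinAbs.natAbs = 1 := by
    rw [ZMod.natAbs_valMinAbs_neg, h1]; rfl
  constructor
  · intro h
    have hne : ∃ ν ∈ Finset.univ, (z ν).valMinAbs.natAbs ≠ 0 := by
      apply Finset.exists_ne_zero_of_sum_ne_zero (f := fun ν => (z ν).valMinAbs.natAbs)
      unfold torusNorm at h; omega
    obtain ⟨ν, -, hν⟩ := hne
    refine ⟨ν, ?_⟩
    have hs := Finset.add_sum_erase Finset.univ (fun ν => (z ν).valMinAbs.natAbs) (Finset.mem_univ ν)
    unfold torusNorm at h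
    have h0 : ∑ x ∈ Finset.univ.erase ν, (z x).valMinAbs.natAbs = 0 := by omega
    have hz : ∀ x, x ≠ ν → z x = 0 := by
      intro x hx
      have := (Finset.sum_eq_zero_iff.1 h0) x (by simp [hx])
      simpa using this
    have hv : (z ν).valMinAbs.natAbs = 1 := by omega
    have hc := ZMod.coe_valMinAbs (z ν)
    rcases Int.natAbs_eq_iff.1 hv with h | h
    · left; ext x; by_cases hx : x = ν
      · subst hx; rw [h] at hc; simpa using hc.symm
      · simp [hx, hz x hx]
    · right; ext x; by_cases hx : x = ν
      · subst hx; rw [h] at hc; simpa using hc.symm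
      · simp [hx, hz x hx]
  · rintro ⟨ν, rfl | rfl⟩
    · unfold torusNorm; rw [Finset.sum_eq_single ν] <;> simp +contextual [h1]
    · unfold torusNorm; rw [Finset.sum_eq_single ν] <;> simp +contextual [h1']

/-- The Fourier transform of the hopping amplitude is real, `ω_ξ = -2 ∑_ν cos ξ_ν`. -/
theorem hoppingFourier_eq {d L : ℕ} [NeZero L] (hL : 3 ≤ L) (k : Lattice d L) :
    hoppingFourier k = ((-(2 * ∑ ν, Real.cos (2*Real.pi * (k ν).val / L)) : ℝ) : ℂ) := by
  have : Fact (1 < L) := ⟨by omega⟩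
  have hne : (1:ZMod L) ≠ -1 := by
    intro h
    have h2 : ((2:ℕ):ZMod L) = 0 := by
      push_cast; linear_combination h
    rw [ZMod.natCast_eq_zero_iff] at h2
    exact absurd (Nat.le_of_dvd (by norm_num) h2) (by omega)
  let f : Fin d × Bool → Lattice d L := fun p => Pi.single p.1 (if p.2 then 1 else -1)
  have hf : Function.Injective f := by
    rintro ⟨a, s⟩ ⟨b, t⟩ h
    have hs : ∀ s : Bool, (if s then 1 else -1 : ZMod L) ≠ 0 := by intro s; cases s <;> simp
    have hab : a = b := by
      by_contra hab
      have := congrFun h a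
      simp only [f, Pi.single_eq_same, Pi.single_eq_of_ne hab] at this
      exact hs s this
    subst hab
    have := congrFun h a
    simp only [f, Pi.single_eq_same] at this
    cases s <;> cases t <;> simp_all [eq_comm]
  have key : hoppingFourier k = ∑ p : Fin d × Bool, Complex.exp (-(Complex.I * (phase k (f p) : ℂ))) * (hopping (f p) : ℂ) := by
    unfold hoppingFourier
    symm
    rw [← Finset.sum_image (s := Finset.univ) (g := f) (f := fun z => Complex.exp (-(Complex.I * (phase k z : ℂ))) * (hopping z : ℂ)) (by intro a _ b _ h; exact hf h)]
    apply Finset.sum_subset (Finset.subset_univ _)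
    intro z _ hz
    have : torusNorm z ≠ 1 := by
      rw [Ne, torusNorm_eq_one_iff hL]
      rintro ⟨ν, h | h⟩
      · exact hz (Finset.mem_image.2 ⟨(ν, true), Finset.mem_univ _, by simp [f, h]⟩)
      · exact hz (Finset.mem_image.2 ⟨(ν, false), Finset.mem_univ _, by simp [f, h]⟩)
    simp [hopping, this]
  have hh : ∀ p, (hopping (f p)) = -1 := by
    intro p
    have : torusNorm (f p) = 1 := by
      rw [torusNorm_eq_one_iff hL]; refine ⟨p.1, ?_⟩
      rcases p with ⟨a, s⟩; cases s <;> simp [f]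
    simp [hopping, this]
  rw [key, Fintype.sum_prod_type]
  simp only [hh]
  push_cast
  rw [Finset.mul_sum, ← Finset.sum_neg_distrib]
  refine Finset.sum_congr rfl fun ν _ => ?_
  have pt : phase k (f (ν, true)) = 2*Real.pi * (k ν).val / L := by
    unfold phase; rw [Finset.sum_eq_single ν] <;> simp +contextual [f, ZMod.val_one]
  have hL0 : (L:ℝ) ≠ 0 := by exact_mod_cast NeZero.ne L
  have pf : phase k (f (ν, false)) = -(2*Real.pi * (k ν).val / L) + (k ν).val * (2 * Real.pi) := by
    unfold phase; rw [Finset.sum_eq_single ν]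
    · have : ((-1 : ZMod L)).val = L - 1 := by rw [ZMod.neg_val, ZMod.val_one]; simp
      simp only [f, Pi.single_eq_same]
      simp only [Bool.false_eq_true, if_false, this]
      rw [Nat.cast_sub (by omega)]; field_simp; push_cast; ring
    · simp +contextual [f]
    · simp
  rw [Fintype.sum_bool, pt, pf, Complex.cos]
  have e2 : Complex.exp (-(Complex.I * ((-(2*Real.pi * (k ν).val / L) + (k ν).val * (2 * Real.pi) : ℝ) : ℂ))) = Complex.exp ((2*Real.pi * (k ν).val / L) * Complex.I) := by
    rw [Complex.exp_eq_exp_iff_exists_int]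
    refine ⟨-((k ν).val : ℤ), ?_⟩
    push_cast; ring
  rw [e2]
  push_cast
  ring_nf

end Hubbard

end

/-!
The lower bound on the Hartree–Fock functional comes from an explicit sum of squares, whose
coefficients are fixed by the gap equation.

Existence and uniqueness of `Δ` (`exists_gapEquation`) follow from monotonicity and continuity of
the right-hand side of the gap equation. Since `4 ∣ L`, the dispersion relation vanishes at
`ξ = (π/2, …, π/2)`, which makes this side large for small `Δ`; as `ω` is not identically zero, it
is smaller than `2` at `Δ = 1/2`.

Write each on-site block as `γ_x = ρ_x / 2 + B_x` with `B_x` traceless, and put `Γ = 1 - 2 γ`,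
`A = T ⊗ 1 - g ⨁_x B_x` and `M = (T² + g² Δ²)^{1/2} ⊗ 1`. The energy is the sum of
`Tr (A γ) = - Tr (A Γ) / 2` and terms quadratic in `ρ_x` and `B_x`. Completing the square,
`2 Tr (A Γ) = Tr (M⁻¹ A²) + Tr M - Tr (M (1 - Γ²)) - ‖M^{-1/2} A - M^{1/2} Γ‖²`
in the Hilbert–Schmidt norm. Here `M⁻¹` has constant diagonal by translation
invariance, and the gap equation says that this diagonal equals `2 / g`. Therefore the part of
`Tr (M⁻¹ A²)` quadratic in `B` cancels the quadratic spin term of the energy exactly, the part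
linear in `B` vanishes since `B_x` is traceless, and the energy is the asserted minimum plus
`(g/4) ∑_x (ρ_x - 1)² + (1/4) ‖M^{-1/2} A - M^{1/2} Γ‖² + (1/4) Tr (M (1 - Γ²))`
(`energy_eq_gapEnergy_add`). All three terms are nonnegative for density matrices.

If they vanish then `A = M Γ` and `Γ² = 1`, so `A² = M²`. Comparing blocks
(`spinMeanField_mul_self_eq_iff`), `B_x² = Δ²` and `B_x + B_y = 0` for neighbours `x, y`; as the
torus is connected, `B_x = (-1)^x Δ e · σ` (`exists_eq_staggered`), and `γ` is the spectral
projection by the polar decomposition (`eq_mul_one_sub_two_nonposProjection`). Conversely, for the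
projection `γ = 1[T - g Δ G (e · σ) ≤ 0]` one has `Γ = M⁻¹ (T - g Δ G (e · σ))`. The symmetry
`ω_{ξ + (π, …, π)} = - ω_ξ` and the gap equation give `γ_x = 1/2 + (-1)^x Δ e · σ`
(`siteBlock_nonposProjection_meanField`), so the state is self-consistent and half-filled, and all
three terms vanish.
-/

open scoped Kronecker ComplexOrder

noncomputable section

namespace Hubbard

variable {d L : ℕ}

/-! ### Plane waves and Fourier multipliers -/

section

variable [NeZero L]

open ZMod in
/-- The choice of representatives in `phase` does not matter: `exp(i ξ·z)` is a character. -/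
theorem cexp_phase (k z : Lattice d L) :
    Complex.exp (Complex.I * (phase k z : ℂ)) = ∏ ν, stdAddChar (k ν * z ν) := by
  have hterm : ∀ ν, stdAddChar (k ν * z ν) =
      Complex.exp
        (Complex.I * ((2 * Real.pi * ((k ν).val : ℝ) / L * ((z ν).val : ℝ) : ℝ) : ℂ)) := by
    intro ν
    have h := stdAddChar_coe (N := L) (((k ν).val * (z ν).val : ℕ) : ℤ)
    rw [Int.cast_natCast, Nat.cast_mul, natCast_zmod_val, natCast_zmod_val] at h
    rw [h]
    congr 1
    push_cast
    ring
  simp only [hterm, ← Complex.exp_sum, phase]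
  congr 1
  push_cast
  rw [Finset.mul_sum]

/-- The matrix of plane waves, with entry `exp(i ξ·x)` at site `x` and momentum `ξ`. -/
def planeWave (d L : ℕ) [NeZero L] : Matrix (Lattice d L) (Lattice d L) ℂ :=
  Matrix.of fun x k => ∏ ν, ZMod.stdAddChar (k ν * x ν)

theorem star_stdAddChar (j : ZMod L) : star (ZMod.stdAddChar j) = ZMod.stdAddChar (-j) := by
  rw [ZMod.stdAddChar_apply, ZMod.stdAddChar_apply, AddChar.map_neg_eq_inv, Circle.coe_inv_eq_conj]
  rfl

theorem planeWave_mul_star (x y k : Lattice d L) :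
    planeWave d L x k * star (planeWave d L y k) = planeWave d L (x - y) k := by
  simp only [planeWave, Matrix.of_apply, star_prod, star_stdAddChar, ← Finset.prod_mul_distrib,
    ← AddChar.map_add_eq_mul]
  refine Finset.prod_congr rfl fun ν _ => ?_
  rw [Pi.sub_apply]
  ring_nf

theorem sum_planeWave (x : Lattice d L) :
    ∑ k, planeWave d L x k = if x = 0 then (Fintype.card (Lattice d L) : ℂ) else 0 := by
  have h : ∑ k, planeWave d L x k = ∏ ν, ∑ j : ZMod L, ZMod.stdAddChar (j * x ν) := by
    rw [Finset.prod_univ_sum, Fintype.piFinset_univ]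
    rfl
  rw [h]
  simp only [AddChar.sum_mulShift _ (ZMod.isPrimitive_stdAddChar L)]
  split_ifs with hx
  · simp [hx]
  · obtain ⟨ν, hν⟩ : ∃ ν, x ν ≠ 0 := by
      by_contra! h0
      exact hx (funext h0)
    exact Finset.prod_eq_zero (Finset.mem_univ ν) (by simp [hν])

theorem planeWave_mul_conjTranspose :
    planeWave d L * (planeWave d L).conjTranspose =
      (Fintype.card (Lattice d L) : ℂ) • (1 : Matrix (Lattice d L) (Lattice d L) ℂ) := by
  ext x y
  simp only [Matrix.mul_apply, Matrix.conjTranspose_apply, planeWave_mul_star, sum_planeWave,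
    Matrix.smul_apply, Matrix.one_apply, sub_eq_zero, smul_eq_mul, mul_ite, mul_one, mul_zero]

theorem card_lattice_ne_zero : (Fintype.card (Lattice d L) : ℂ) ≠ 0 :=
  Nat.cast_ne_zero.2 Fintype.card_ne_zero

theorem conjTranspose_mul_planeWave :
    (planeWave d L).conjTranspose * planeWave d L =
      (Fintype.card (Lattice d L) : ℂ) • (1 : Matrix (Lattice d L) (Lattice d L) ℂ) := by
  have h : planeWave d L *
      ((Fintype.card (Lattice d L) : ℂ)⁻¹ • (planeWave d L).conjTranspose) = 1 := by
    rw [Matrix.mul_smul, planeWave_mul_conjTranspose, smul_smul,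
      inv_mul_cancel₀ card_lattice_ne_zero, one_smul]
  have h2 := mul_eq_one_comm.1 h
  rw [Matrix.smul_mul] at h2
  rw [← h2, smul_smul, mul_inv_cancel₀ card_lattice_ne_zero, one_smul]

/-- The Fourier multiplier with symbol `f`, i.e. the function `f` of the momentum operator. -/
def multiplier (f : Lattice d L → ℝ) : Matrix (Lattice d L) (Lattice d L) ℂ :=
  (Fintype.card (Lattice d L) : ℂ)⁻¹ •
    (planeWave d L * Matrix.diagonal (fun k => (f k : ℂ)) * (planeWave d L).conjTranspose)

theorem multiplier_mul (f h : Lattice d L → ℝ) :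
    multiplier f * multiplier h = multiplier (f * h) := by
  simp only [multiplier, Matrix.smul_mul, Matrix.mul_smul]
  have : planeWave d L * Matrix.diagonal (fun k => (f k : ℂ)) * (planeWave d L).conjTranspose *
      (planeWave d L * Matrix.diagonal (fun k => (h k : ℂ)) * (planeWave d L).conjTranspose) =
      planeWave d L * (Matrix.diagonal (fun k => (f k : ℂ)) *
        ((planeWave d L).conjTranspose * planeWave d L) * Matrix.diagonal (fun k => (h k : ℂ))) *
          (planeWave d L).conjTranspose := by
    simp only [Matrix.mul_assoc]
  rw [this, conjTranspose_mul_planeWave, Matrix.mul_smul, Matrix.mul_one, Matrix.smul_mul,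
    Matrix.diagonal_mul_diagonal, Matrix.mul_smul, Matrix.smul_mul, smul_smul,
    smul_smul, mul_assoc, inv_mul_cancel₀ card_lattice_ne_zero, mul_one]
  simp

theorem multiplier_one : multiplier (1 : Lattice d L → ℝ) = 1 := by
  simp [multiplier, planeWave_mul_conjTranspose, smul_smul]

theorem multiplier_isHermitian (f : Lattice d L → ℝ) : (multiplier f).IsHermitian := by
  rw [Matrix.IsHermitian, multiplier, Matrix.conjTranspose_smul, Matrix.conjTranspose_mul,
    Matrix.conjTranspose_mul, Matrix.conjTranspose_conjTranspose, Matrix.diagonal_conjTranspose,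
    ← Matrix.mul_assoc]
  congr 1
  · simp
  · congr 3
    ext k
    simp

theorem multiplier_apply (f : Lattice d L → ℝ) (x y : Lattice d L) :
    multiplier f x y =
      (Fintype.card (Lattice d L) : ℂ)⁻¹ * ∑ k, (f k : ℂ) * planeWave d L (x - y) k := by
  rw [multiplier, Matrix.smul_apply, Matrix.mul_apply, smul_eq_mul]
  simp only [Matrix.mul_diagonal, Matrix.conjTranspose_apply, ← planeWave_mul_star]
  congr 1
  exact Finset.sum_congr rfl fun k _ => by ring

/-- The diagonal of a Fourier multiplier is constant, by translation invariance. -/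
theorem multiplier_apply_self (f : Lattice d L → ℝ) (x : Lattice d L) :
    multiplier f x x = (momentumAverage f : ℂ) := by
  rw [multiplier_apply, momentumAverage]
  simp [planeWave]

theorem trace_multiplier (f : Lattice d L → ℝ) : (multiplier f).trace = ((∑ k, f k : ℝ) : ℂ) := by
  have : (Fintype.card (Lattice d L) : ℝ) ≠ 0 := Nat.cast_ne_zero.2 Fintype.card_ne_zero
  simp only [Matrix.trace, Matrix.diag_apply, multiplier_apply_self, Finset.sum_const,
    Finset.card_univ, nsmul_eq_mul, momentumAverage]
  rw [← Complex.ofReal_natCast, ← Complex.ofReal_mul, ← mul_assoc, mul_inv_cancel₀ this, one_mul]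

theorem multiplier_add_const (f : Lattice d L → ℝ) (c : ℝ) :
    multiplier (fun k => f k + c) = multiplier f + (c : ℂ) • 1 := by
  ext x y
  rw [Matrix.add_apply, Matrix.smul_apply, ← multiplier_one, multiplier_apply, multiplier_apply,
    multiplier_apply, smul_eq_mul, mul_left_comm, ← mul_add,
    Finset.mul_sum _ _ (c : ℂ), ← Finset.sum_add_distrib]
  congr 1
  refine Finset.sum_congr rfl fun k _ => ?_
  rw [Pi.one_apply]
  push_cast
  ring

end

/-! ### The dispersion relation -/

section

variable [NeZero L]

theorem ofReal_dispersion (hL : 3 ≤ L) (k : Lattice d L) :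
    (dispersion k : ℂ) = hoppingFourier k := by
  rw [dispersion, hoppingFourier_eq hL, Complex.ofReal_re]

theorem dispersion_eq (hL : 3 ≤ L) (k : Lattice d L) :
    dispersion k = -(2 * ∑ ν, Real.cos (2 * Real.pi * (k ν).val / L)) := by
  rw [dispersion, hoppingFourier_eq hL, Complex.ofReal_re]

/-- Hopping is diagonalized by the plane waves, with eigenvalues `ω_ξ`. -/
theorem hoppingMatrix_eq_multiplier (hL : 3 ≤ L) :
    hoppingMatrix d L = multiplier dispersion := by
  have hexp : ∀ k z : Lattice d L,
      Complex.exp (-(Complex.I * (phase k z : ℂ))) = star (planeWave d L z k) := by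
    intro k z
    rw [planeWave, Matrix.of_apply, ← cexp_phase, Complex.star_def, ← Complex.exp_conj]
    simp
  ext x y
  rw [multiplier_apply]
  simp only [ofReal_dispersion hL, hoppingFourier, hexp, Finset.sum_mul]
  have : ∀ k z : Lattice d L, star (planeWave d L z k) * (hopping z : ℂ) * planeWave d L (x - y) k =
      (hopping z : ℂ) * planeWave d L (x - y - z) k := by
    intro k z
    rw [← planeWave_mul_star (x - y) z]
    ring
  rw [Finset.sum_comm]
  simp only [this, ← Finset.mul_sum, sum_planeWave, sub_eq_zero, mul_ite, mul_zero,
    Finset.sum_ite_eq, Finset.mem_univ, if_true]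
  rw [mul_comm, mul_assoc, mul_inv_cancel₀ card_lattice_ne_zero, mul_one]
  rfl

/-- Shifting the momentum by `(π, …, π)` flips the sign of the dispersion relation. -/
theorem dispersion_add_half (hL : 3 ≤ L) (h2 : 2 ∣ L) (k : Lattice d L) :
    dispersion (k + fun _ => ((L / 2 : ℕ) : ZMod L)) = -dispersion k := by
  have hL0 : (L : ℂ) ≠ 0 := Nat.cast_ne_zero.2 (NeZero.ne L)
  have hcos : ∀ j : ZMod L, Real.cos (2 * Real.pi * j.val / L) = (ZMod.stdAddChar j).re := by
    intro j
    rw [ZMod.stdAddChar_apply, ZMod.toCircle_eq_circleExp, Circle.coe_exp,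
      Complex.exp_ofReal_mul_I_re, mul_div_assoc]
  have hpi : ZMod.stdAddChar ((L / 2 : ℕ) : ZMod L) = -1 := by
    obtain ⟨m, hm⟩ := h2
    have h := ZMod.stdAddChar_coe (N := L) ((L / 2 : ℕ) : ℤ)
    rw [Int.cast_natCast] at h
    rw [h, ← Complex.exp_pi_mul_I]
    congr 1
    have : L / 2 = m := by omega
    have h' : (L : ℂ) = 2 * m := by exact_mod_cast hm
    rw [this, div_eq_iff hL0, h']
    push_cast
    ring
  simp only [dispersion_eq hL, hcos, Pi.add_apply, AddChar.map_add_eq_mul, hpi]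
  simp

/-- A function of the momentum that changes sign under a shift averages to zero. -/
theorem momentumAverage_eq_zero_of_add_eq_neg {f : Lattice d L → ℝ} (a : Lattice d L)
    (hf : ∀ k, f (k + a) = -f k) : momentumAverage f = 0 := by
  have h : ∑ k, f (k + a) = ∑ k, f k := Equiv.sum_comp (Equiv.addRight a) f
  simp only [hf, Finset.sum_neg_distrib] at h
  rw [momentumAverage, show ∑ k, f k = 0 by linarith, mul_zero]

theorem dispersion_zero (hL : 3 ≤ L) : dispersion (0 : Lattice d L) = -(2 * d) := by
  simp [dispersion_eq hL]

theorem dispersion_quarter (hL : 3 ≤ L) (h4 : 4 ∣ L) :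
    dispersion (fun _ => ((L / 4 : ℕ) : ZMod L) : Lattice d L) = 0 := by
  obtain ⟨m, hm⟩ := h4
  have hm4 : L / 4 = m := by omega
  have hL0 : (L : ℝ) = 4 * m := by exact_mod_cast hm
  have hm0 : (m : ℝ) ≠ 0 := by
    rintro h
    have : m = 0 := by exact_mod_cast h
    omega
  have : 2 * Real.pi * (m : ℝ) / L = Real.pi / 2 := by
    rw [hL0]
    field_simp
    ring
  simp [dispersion_eq hL, hm4, ZMod.val_natCast_of_lt (show m < L by omega), this]

end

/-! ### The gap equation -/

section

variable [NeZero L]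

/-- The mean-field dispersion `√(ω_ξ² + g² Δ²)`. -/
def quasiDispersion (g Δ : ℝ) (k : Lattice d L) : ℝ := √(dispersion k ^ 2 + g ^ 2 * Δ ^ 2)

theorem quasiDispersion_pos {g Δ : ℝ} (hg : 0 < g) (hΔ : 0 < Δ) (k : Lattice d L) :
    0 < quasiDispersion g Δ k :=
  Real.sqrt_pos.2 (by positivity)

theorem quasiDispersion_sq (g Δ : ℝ) (k : Lattice d L) :
    quasiDispersion g Δ k ^ 2 = dispersion k ^ 2 + g ^ 2 * Δ ^ 2 :=
  Real.sq_sqrt (by positivity)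

theorem gapEquation_iff (g Δ : ℝ) :
    GapEquation d L g Δ ↔
      2 = g * momentumAverage fun k : Lattice d L => (quasiDispersion g Δ k)⁻¹ := by
  have h : ∀ k : Lattice d L, (dispersion k ^ 2 + g ^ 2 * Δ ^ 2) ^ (-(1 / 2) : ℝ) =
      (quasiDispersion g Δ k)⁻¹ := by
    intro k
    rw [Real.rpow_neg (by positivity), ← Real.sqrt_eq_rpow, quasiDispersion]
  simp only [GapEquation, h, momentumAverage, ← Finset.mul_sum]
  rw [mul_left_comm]

theorem momentumAverage_lt {f h : Lattice d L → ℝ} (hle : ∀ k, f k ≤ h k)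
    (hlt : ∃ k, f k < h k) : momentumAverage f < momentumAverage h := by
  obtain ⟨k, hk⟩ := hlt
  refine mul_lt_mul_of_pos_left ?_ (inv_pos.2 (Nat.cast_pos.2 Fintype.card_pos))
  exact Finset.sum_lt_sum (fun k _ => hle k) ⟨k, Finset.mem_univ k, hk⟩

theorem momentumAverage_const (c : ℝ) : momentumAverage (fun _ : Lattice d L => c) = c := by
  have : (Fintype.card (Lattice d L) : ℝ) ≠ 0 := Nat.cast_ne_zero.2 Fintype.card_ne_zero
  rw [momentumAverage, Finset.sum_const, Finset.card_univ, nsmul_eq_mul, inv_mul_cancel_left₀ this]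

theorem momentumAverage_inv_quasiDispersion_strictAntiOn {g : ℝ} (hg : 0 < g) :
    StrictAntiOn
      (fun Δ => momentumAverage fun k : Lattice d L => (quasiDispersion g Δ k)⁻¹) (Set.Ioi 0) := by
  intro a ha b _ hab
  have ha : 0 < a := ha
  have h : ∀ k : Lattice d L, (quasiDispersion g b k)⁻¹ < (quasiDispersion g a k)⁻¹ := by
    intro k
    refine inv_strictAnti₀ (quasiDispersion_pos hg ha k) (Real.sqrt_lt_sqrt (by positivity) ?_)
    gcongr
  exact momentumAverage_lt (fun k => (h k).le) ⟨0, h 0⟩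

theorem continuousOn_momentumAverage_inv_quasiDispersion {g : ℝ} (hg : 0 < g) :
    ContinuousOn (fun Δ => momentumAverage fun k : Lattice d L => (quasiDispersion g Δ k)⁻¹)
      (Set.Ioi 0) := by
  refine continuousOn_const.mul (continuousOn_finsetSum _ fun k _ => ?_)
  refine ContinuousOn.inv₀ ?_ fun Δ hΔ => (quasiDispersion_pos hg hΔ k).ne'
  unfold quasiDispersion
  fun_prop

/-- Existence uses the zero of the dispersion relation at `ξ = (π/2, …, π/2)`, which makes the
right-hand side of the gap equation large for small `Δ`; the strict bound `Δ < 1/2` uses its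
nonzero value at `ξ = 0`. -/
theorem exists_gapEquation {g : ℝ} (hd : 0 < d) (hL : 4 ∣ L) (hg : 0 < g) :
    ∃ Δ : ℝ, (0 < Δ ∧ Δ < 1 / 2) ∧ GapEquation d L g Δ ∧
      ∀ Δ' : ℝ, 0 < Δ' → GapEquation d L g Δ' → Δ' = Δ := by
  have hL3 : 3 ≤ L := le_trans (by norm_num) (Nat.le_of_dvd (Nat.pos_of_ne_zero (NeZero.ne L)) hL)
  set F : ℝ → ℝ := fun Δ => momentumAverage fun k : Lattice d L => (quasiDispersion g Δ k)⁻¹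
    with hF
  have hhalf : F (1 / 2) < 2 / g := by
    have hbound : ∀ k : Lattice d L, g / 2 ≤ quasiDispersion g (1 / 2) k := by
      intro k
      refine Real.le_sqrt_of_sq_le ?_
      nlinarith [sq_nonneg (dispersion k)]
    rw [← momentumAverage_const (d := d) (L := L) (2 / g)]
    refine momentumAverage_lt (fun k => ?_) ⟨0, ?_⟩
    · rw [← inv_div g 2]
      exact inv_anti₀ (by positivity) (hbound k)
    · rw [← inv_div g 2]
      refine inv_strictAnti₀ (by positivity) (Real.lt_sqrt_of_sq_lt ?_)
      have : (0 : ℝ) < d := Nat.cast_pos.2 hd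
      rw [dispersion_zero hL3]
      nlinarith
  -- A single term of the sum, at `ω_ξ = 0`, is already `(g Δ)⁻¹`, so `Δ = 1 / (4 |Λ|)` is small
  -- enough.
  set N : ℝ := (Fintype.card (Lattice d L) : ℝ) with hN
  have hN1 : 1 ≤ N := Nat.one_le_cast.2 Fintype.card_pos
  have ha0 : 0 < 1 / (4 * N) := by positivity
  have ha1 : 1 / (4 * N) < 1 / 2 := one_div_lt_one_div_of_lt (by norm_num) (by linarith)
  have hsmall : 2 / g < F (1 / (4 * N)) := by
    have h1 : (quasiDispersion g (1 / (4 * N))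
        (fun _ => ((L / 4 : ℕ) : ZMod L) : Lattice d L))⁻¹ = 4 * N / g := by
      rw [quasiDispersion, dispersion_quarter hL3 hL, ← mul_pow, zero_pow two_ne_zero, zero_add,
        Real.sqrt_sq (by positivity)]
      field_simp
    have h2 := Finset.single_le_sum
      (f := fun k : Lattice d L => (quasiDispersion g (1 / (4 * N)) k)⁻¹)
      (fun k _ => (inv_pos.2 (quasiDispersion_pos hg ha0 k)).le)
      (Finset.mem_univ (fun _ => ((L / 4 : ℕ) : ZMod L)))
    rw [h1] at h2
    have h3 : F (1 / (4 * N)) = N⁻¹ * ∑ k : Lattice d L, (quasiDispersion g (1 / (4 * N)) k)⁻¹ :=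
      rfl
    have h4 : 4 / g ≤ F (1 / (4 * N)) := by
      rw [h3]
      calc 4 / g = N⁻¹ * (4 * N / g) := by field_simp
        _ ≤ _ := mul_le_mul_of_nonneg_left h2 (by positivity)
    refine lt_of_lt_of_le ?_ h4
    gcongr
    norm_num
  have hiff : ∀ Δ, GapEquation d L g Δ ↔ F Δ = 2 / g := by
    intro Δ
    rw [gapEquation_iff, eq_div_iff hg.ne', mul_comm, eq_comm]
  have hcont : ContinuousOn F (Set.Icc (1 / (4 * N)) (1 / 2)) :=
    (continuousOn_momentumAverage_inv_quasiDispersion hg).mono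
      fun x hx => lt_of_lt_of_le ha0 hx.1
  obtain ⟨Δ, hΔ, hFΔ⟩ := intermediate_value_Ioo' ha1.le hcont ⟨hhalf, hsmall⟩
  refine ⟨Δ, ⟨ha0.trans hΔ.1, hΔ.2⟩, (hiff Δ).2 hFΔ, fun Δ' h0 h' => ?_⟩
  exact (momentumAverage_inv_quasiDispersion_strictAntiOn hg).injOn h0 (ha0.trans hΔ.1)
    (((hiff Δ').1 h').trans hFΔ.symm)

end

/-! ### On-site blocks and local spin operators -/

/-- The operator, block diagonal in position space, with spin matrix `B x` at the site `x`. -/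
def spinField (B : Lattice d L → Matrix (Fin 2) (Fin 2) ℂ) :
    Matrix (Orbital d L) (Orbital d L) ℂ :=
  Matrix.of fun p q => if p.1 = q.1 then B p.1 p.2 q.2 else 0

/-- The on-site block `γ_x`. -/
def siteBlock (γ : Matrix (Orbital d L) (Orbital d L) ℂ) (x : Lattice d L) :
    Matrix (Fin 2) (Fin 2) ℂ :=
  Matrix.of fun σ τ => γ (x, σ) (x, τ)

/-- The traceless part of `γ_x`, i.e. `s_x · σ` where `s_x` is the spin density at `x`. -/
def spinPart (γ : Matrix (Orbital d L) (Orbital d L) ℂ) (x : Lattice d L) :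
    Matrix (Fin 2) (Fin 2) ℂ :=
  siteBlock γ x - ((siteBlock γ x).trace / 2) • 1

theorem spinField_isHermitian {B : Lattice d L → Matrix (Fin 2) (Fin 2) ℂ}
    (hB : ∀ x, (B x).IsHermitian) : (spinField B).IsHermitian := by
  ext p q
  rw [Matrix.conjTranspose_apply]
  by_cases h : q.1 = p.1
  · simpa [spinField, h] using congrFun (congrFun (hB p.1).eq p.2) q.2
  · simp [spinField, h, Ne.symm h]

section

variable {γ : Matrix (Orbital d L) (Orbital d L) ℂ}

theorem siteBlock_isHermitian (hγ : γ.IsHermitian) (x : Lattice d L) :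
    (siteBlock γ x).IsHermitian := by
  ext σ τ
  exact congrFun (congrFun hγ.eq (x, σ)) (x, τ)

theorem ofReal_re_trace_siteBlock (hγ : γ.IsHermitian) (x : Lattice d L) :
    (((siteBlock γ x).trace.re : ℝ) : ℂ) = (siteBlock γ x).trace := by
  have h := congrArg Matrix.trace (siteBlock_isHermitian hγ x).eq
  rw [Matrix.trace_conjTranspose] at h
  exact Complex.conj_eq_iff_re.1 h

theorem spinPart_isHermitian (hγ : γ.IsHermitian) (x : Lattice d L) :
    (spinPart γ x).IsHermitian := by
  rw [Matrix.IsHermitian, spinPart, Matrix.conjTranspose_sub, (siteBlock_isHermitian hγ x).eq,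
    Matrix.conjTranspose_smul, Matrix.conjTranspose_one, ← ofReal_re_trace_siteBlock hγ x]
  simp

theorem spinPart_trace (γ : Matrix (Orbital d L) (Orbital d L) ℂ) (x : Lattice d L) :
    (spinPart γ x).trace = 0 := by
  rw [spinPart, Matrix.trace_sub, Matrix.trace_smul, Matrix.trace_one]
  simp

theorem trace_spinPart_mul_siteBlock (γ : Matrix (Orbital d L) (Orbital d L) ℂ)
    (x : Lattice d L) :
    (spinPart γ x * siteBlock γ x).trace = (spinPart γ x * spinPart γ x).trace := by
  have h : siteBlock γ x = spinPart γ x + ((siteBlock γ x).trace / 2) • 1 := by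
    simp [spinPart]
  conv_lhs => rw [h]
  rw [Matrix.mul_add, Matrix.trace_add, Matrix.mul_smul, Matrix.mul_one, Matrix.trace_smul,
    spinPart_trace, smul_zero, add_zero]

end

/-! ### The mean-field operator of a spin configuration -/

section

variable [NeZero L]

/-- The Fourier multiplier with symbol `f`, acting trivially on spin. -/
def orbitalMultiplier (f : Lattice d L → ℝ) : Matrix (Orbital d L) (Orbital d L) ℂ :=
  multiplier f ⊗ₖ (1 : Matrix (Fin 2) (Fin 2) ℂ)

theorem orbitalMultiplier_mul (f h : Lattice d L → ℝ) :
    orbitalMultiplier f * orbitalMultiplier h = orbitalMultiplier (f * h) := by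
  rw [orbitalMultiplier, orbitalMultiplier, ← Matrix.mul_kronecker_mul, multiplier_mul, mul_one]
  rfl

theorem orbitalMultiplier_one : orbitalMultiplier (1 : Lattice d L → ℝ) = 1 := by
  rw [orbitalMultiplier, multiplier_one, Matrix.one_kronecker_one]

theorem orbitalMultiplier_isHermitian (f : Lattice d L → ℝ) :
    (orbitalMultiplier f).IsHermitian := by
  rw [Matrix.IsHermitian, orbitalMultiplier, Matrix.conjTranspose_kronecker,
    (multiplier_isHermitian f).eq, Matrix.conjTranspose_one]

theorem trace_orbitalMultiplier (f : Lattice d L → ℝ) :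
    (orbitalMultiplier f).trace = 2 * ((∑ k, f k : ℝ) : ℂ) := by
  rw [orbitalMultiplier, Matrix.trace_kronecker, trace_multiplier, Matrix.trace_one, mul_comm]
  simp

theorem orbitalMultiplier_mul_spinField (f : Lattice d L → ℝ)
    (B : Lattice d L → Matrix (Fin 2) (Fin 2) ℂ) (p q : Orbital d L) :
    (orbitalMultiplier f * spinField B) p q = multiplier f p.1 q.1 * B q.1 p.2 q.2 := by
  rw [Matrix.mul_apply, Fintype.sum_prod_type, Finset.sum_eq_single q.1]
  · simp [orbitalMultiplier, spinField, Matrix.one_apply]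
  · intro y _ hy
    simp [spinField, hy]
  · simp

theorem spinField_mul_orbitalMultiplier (f : Lattice d L → ℝ)
    (B : Lattice d L → Matrix (Fin 2) (Fin 2) ℂ) (p q : Orbital d L) :
    (spinField B * orbitalMultiplier f) p q = multiplier f p.1 q.1 * B p.1 p.2 q.2 := by
  rw [Matrix.mul_apply, Fintype.sum_prod_type, Finset.sum_eq_single p.1]
  · simp [orbitalMultiplier, spinField, Matrix.one_apply, mul_comm]
  · intro y _ hy
    simp [spinField, hy.symm]
  · simp

/-- The trace of a multiplier times a local spin operator factorizes, since a multiplier has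
constant diagonal. -/
theorem trace_orbitalMultiplier_mul_spinField (f : Lattice d L → ℝ)
    (B : Lattice d L → Matrix (Fin 2) (Fin 2) ℂ) :
    (orbitalMultiplier f * spinField B).trace = (momentumAverage f : ℂ) * ∑ x, (B x).trace := by
  simp only [Matrix.trace, Matrix.diag_apply, orbitalMultiplier_mul_spinField,
    multiplier_apply_self, Fintype.sum_prod_type, Finset.mul_sum]

theorem spinField_mul (B C : Lattice d L → Matrix (Fin 2) (Fin 2) ℂ) :
    spinField B * spinField C = spinField fun x => B x * C x := by
  ext p q
  rw [Matrix.mul_apply, Fintype.sum_prod_type, Finset.sum_eq_single p.1]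
  · by_cases h : p.1 = q.1 <;> simp [spinField, Matrix.mul_apply, h]
  · intro y _ hy
    simp [spinField, hy.symm]
  · simp

theorem trace_spinField_mul (B : Lattice d L → Matrix (Fin 2) (Fin 2) ℂ)
    (γ : Matrix (Orbital d L) (Orbital d L) ℂ) :
    (spinField B * γ).trace = ∑ x, (B x * siteBlock γ x).trace := by
  simp only [Matrix.trace, Matrix.diag_apply, Matrix.mul_apply, Fintype.sum_prod_type, siteBlock,
    Matrix.of_apply, spinField]
  refine Finset.sum_congr rfl fun x _ => Finset.sum_congr rfl fun σ _ => ?_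
  rw [Finset.sum_eq_single x]
  · simp
  · intro y _ hy
    simp [hy.symm]
  · simp

theorem spinField_trace (B : Lattice d L → Matrix (Fin 2) (Fin 2) ℂ) :
    (spinField B).trace = ∑ x, (B x).trace := by
  simp [Matrix.trace, Fintype.sum_prod_type, spinField]

theorem sum_trace_siteBlock (γ : Matrix (Orbital d L) (Orbital d L) ℂ) :
    ∑ x, (siteBlock γ x).trace = γ.trace := by
  simp [Matrix.trace, Fintype.sum_prod_type, siteBlock]

/-- The Hubbard mean-field operator `T ⊗ 1 - g ⨁_x B x`. -/
def spinMeanField (g : ℝ) (B : Lattice d L → Matrix (Fin 2) (Fin 2) ℂ) :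
    Matrix (Orbital d L) (Orbital d L) ℂ :=
  orbitalMultiplier dispersion - (g : ℂ) • spinField B

theorem spinMeanField_isHermitian (g : ℝ) {B : Lattice d L → Matrix (Fin 2) (Fin 2) ℂ}
    (hB : ∀ x, (B x).IsHermitian) : (spinMeanField g B).IsHermitian := by
  rw [Matrix.IsHermitian, spinMeanField, Matrix.conjTranspose_sub, Matrix.conjTranspose_smul,
    (orbitalMultiplier_isHermitian _).eq, (spinField_isHermitian hB).eq]
  simp

/-- The energy split into the mean-field part and the quadratic terms in charge and spin. -/
theorem energy_eq_re_trace_spinMeanField (hL : 3 ≤ L) (g : ℝ)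
    {γ : Matrix (Orbital d L) (Orbital d L) ℂ} (hγ : γ.IsHermitian) :
    energy g γ = (spinMeanField g (spinPart γ) * γ).trace.re +
      g / 2 * ∑ x, (spinPart γ x * spinPart γ x).trace.re +
      g / 4 * ∑ x, (siteBlock γ x).trace.re ^ 2 := by
  have hx : ∀ x, (∑ σ : Fin 2, ∑ τ : Fin 2,
      (γ (x, σ) (x, σ) * γ (x, τ) (x, τ) - γ (x, σ) (x, τ) * γ (x, τ) (x, σ))).re =
      (siteBlock γ x).trace.re ^ 2 / 2 - (spinPart γ x * spinPart γ x).trace.re := by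
    intro x
    have h1 : ∑ σ : Fin 2, ∑ τ : Fin 2,
        (γ (x, σ) (x, σ) * γ (x, τ) (x, τ) - γ (x, σ) (x, τ) * γ (x, τ) (x, σ)) =
        (siteBlock γ x).trace ^ 2 / 2 - (spinPart γ x * spinPart γ x).trace := by
      simp [spinPart, siteBlock, Matrix.trace_fin_two, Matrix.mul_apply, Fin.sum_univ_two]
      ring
    rw [h1, ← ofReal_re_trace_siteBlock hγ x]
    norm_cast
  rw [energy_eq, Complex.re_sum, Finset.sum_congr rfl fun x _ => hx x, spinMeanField,
    Matrix.sub_mul, Matrix.trace_sub, Matrix.smul_mul, Matrix.trace_smul, trace_spinField_mul,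
    hoppingMatrix_eq_multiplier hL,
    Finset.sum_congr rfl fun x _ => trace_spinPart_mul_siteBlock γ x,
    orbitalMultiplier, Complex.sub_re, smul_eq_mul, Complex.re_ofReal_mul, Complex.re_sum,
    Finset.sum_sub_distrib, ← Finset.sum_div]
  ring

end

/-! ### The energy as a sum of squares -/

section

variable [NeZero L]

/-- Completing the square in `tr (A Γ)` relative to a weight `R` with inverse `S`. -/
theorem two_mul_trace_mul_eq {ι : Type*} [Fintype ι] [DecidableEq ι] {A Γ R S : Matrix ι ι ℂ}
    (hA : A.IsHermitian) (hΓ : Γ.IsHermitian) (hR : R.IsHermitian) (hS : S.IsHermitian)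
    (hRS : R * S = 1) :
    2 * (A * Γ).trace = (S * S * (A * A)).trace + (R * R).trace -
      (R * (1 - Γ * Γ) * R).trace - ((S * A - R * Γ).conjTranspose * (S * A - R * Γ)).trace := by
  have hSR : S * R = 1 := mul_eq_one_comm.1 hRS
  have e1 : (S * A - R * Γ).conjTranspose * (S * A - R * Γ) =
      A * (S * S) * A - A * Γ - Γ * A + Γ * (R * R) * Γ := by
    rw [Matrix.conjTranspose_sub, Matrix.conjTranspose_mul, Matrix.conjTranspose_mul, hA.eq, hΓ.eq,
      hR.eq, hS.eq]
    have h1 : A * S * (R * Γ) = A * Γ := by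
      rw [Matrix.mul_assoc, ← Matrix.mul_assoc S, hSR, Matrix.one_mul]
    have h2 : Γ * R * (S * A) = Γ * A := by
      rw [Matrix.mul_assoc, ← Matrix.mul_assoc R, hRS, Matrix.one_mul]
    rw [Matrix.sub_mul, Matrix.mul_sub, Matrix.mul_sub, h1, h2]
    simp only [Matrix.mul_assoc]
    abel
  have e2 : R * (1 - Γ * Γ) * R = R * R - R * Γ * (Γ * R) := by
    rw [Matrix.mul_sub, Matrix.sub_mul, Matrix.mul_one]
    simp only [Matrix.mul_assoc]
  have t1 : (A * (S * S) * A).trace = (S * S * (A * A)).trace := by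
    rw [Matrix.mul_assoc, Matrix.trace_mul_comm, Matrix.mul_assoc]
  have t2 : (Γ * (R * R) * Γ).trace = (R * Γ * (Γ * R)).trace := by
    rw [← Matrix.mul_assoc, Matrix.mul_assoc (Γ * R), Matrix.trace_mul_comm]
  rw [e1, e2, Matrix.trace_add, Matrix.trace_sub, Matrix.trace_sub, Matrix.trace_sub, t1, t2,
    Matrix.trace_mul_comm Γ A]
  ring

theorem spinMeanField_mul_self (g : ℝ) (B : Lattice d L → Matrix (Fin 2) (Fin 2) ℂ) :
    spinMeanField g B * spinMeanField g B =
      orbitalMultiplier (dispersion ^ 2) -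
        (g : ℂ) • (orbitalMultiplier dispersion * spinField B +
          spinField B * orbitalMultiplier dispersion) +
        ((g : ℂ) ^ 2) • spinField fun x => B x * B x := by
  rw [spinMeanField, Matrix.sub_mul, Matrix.mul_sub, Matrix.mul_sub, orbitalMultiplier_mul,
    Matrix.mul_smul, Matrix.smul_mul, Matrix.smul_mul, Matrix.mul_smul, spinField_mul, smul_smul,
    ← sq, ← sq, smul_add]
  abel

/-- The terms of `A²` linear in the spin field do not contribute, because the spin matrices are
traceless. -/
theorem trace_orbitalMultiplier_mul_spinMeanField_sq (g : ℝ) (f : Lattice d L → ℝ)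
    {B : Lattice d L → Matrix (Fin 2) (Fin 2) ℂ} (hB : ∀ x, (B x).trace = 0) :
    (orbitalMultiplier f * (spinMeanField g B * spinMeanField g B)).trace =
      2 * ((∑ k, f k * dispersion k ^ 2 : ℝ) : ℂ) +
        (g : ℂ) ^ 2 * momentumAverage f * ∑ x, (B x * B x).trace := by
  have h0 : ∀ h : Lattice d L → ℝ, (orbitalMultiplier h * spinField B).trace = 0 := by
    intro h
    rw [trace_orbitalMultiplier_mul_spinField]
    simp [hB]
  rw [spinMeanField_mul_self, Matrix.mul_add, Matrix.mul_sub, Matrix.mul_smul, Matrix.mul_smul,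
    Matrix.mul_add, Matrix.trace_add, Matrix.trace_sub, Matrix.trace_smul, Matrix.trace_smul,
    Matrix.trace_add, ← Matrix.mul_assoc, ← Matrix.mul_assoc,
    Matrix.trace_mul_comm _ (orbitalMultiplier dispersion), ← Matrix.mul_assoc,
    orbitalMultiplier_mul, orbitalMultiplier_mul, orbitalMultiplier_mul, h0, h0,
    trace_orbitalMultiplier_mul_spinField, trace_orbitalMultiplier]
  simp [mul_assoc]

theorem trace_spinMeanField (hL : 3 ≤ L) (g : ℝ)
    {B : Lattice d L → Matrix (Fin 2) (Fin 2) ℂ} (hB : ∀ x, (B x).trace = 0) :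
    (spinMeanField g B).trace = 0 := by
  have h : (multiplier (dispersion : Lattice d L → ℝ)).trace = 0 := by
    rw [← hoppingMatrix_eq_multiplier hL]
    simp [Matrix.trace, hoppingMatrix, hopping, torusNorm]
  rw [spinMeanField, orbitalMultiplier, Matrix.trace_sub, Matrix.trace_smul, spinField_trace,
    Matrix.trace_kronecker, h]
  simp [hB]

/-- The value of the Hartree–Fock energy at the solution of the gap equation. -/
def gapEnergy (d L : ℕ) [NeZero L] (g Δ : ℝ) : ℝ :=
  (Fintype.card (Lattice d L) : ℝ) * (g / 4 + g * Δ ^ 2) -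
    ∑ k : Lattice d L, quasiDispersion g Δ k

/-- The square root of the weight `M = (T² + g² Δ²)^{1/2}`, acting trivially on spin. -/
def rootWeight (d L : ℕ) [NeZero L] (g Δ : ℝ) : Matrix (Orbital d L) (Orbital d L) ℂ :=
  orbitalMultiplier fun k => √(quasiDispersion g Δ k)

/-- The inverse of `rootWeight`. -/
def rootWeightInv (d L : ℕ) [NeZero L] (g Δ : ℝ) : Matrix (Orbital d L) (Orbital d L) ℂ :=
  orbitalMultiplier fun k => (√(quasiDispersion g Δ k))⁻¹

theorem rootWeight_isHermitian (g Δ : ℝ) : (rootWeight d L g Δ).IsHermitian :=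
  orbitalMultiplier_isHermitian _

theorem rootWeightInv_isHermitian (g Δ : ℝ) : (rootWeightInv d L g Δ).IsHermitian :=
  orbitalMultiplier_isHermitian _

theorem rootWeight_mul_self (g Δ : ℝ) :
    rootWeight d L g Δ * rootWeight d L g Δ = orbitalMultiplier (quasiDispersion g Δ) := by
  rw [rootWeight, orbitalMultiplier_mul]
  congr 1
  ext k
  exact Real.mul_self_sqrt (Real.sqrt_nonneg _)

theorem rootWeightInv_mul_self (g Δ : ℝ) :
    rootWeightInv d L g Δ * rootWeightInv d L g Δ =
      orbitalMultiplier fun k => (quasiDispersion g Δ k)⁻¹ := by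
  rw [rootWeightInv, orbitalMultiplier_mul]
  congr 1
  ext k
  rw [Pi.mul_apply, ← mul_inv]
  exact congrArg _ (Real.mul_self_sqrt (Real.sqrt_nonneg _))

theorem rootWeight_mul_rootWeightInv {g Δ : ℝ} (hg : 0 < g) (hΔ : 0 < Δ) :
    rootWeight d L g Δ * rootWeightInv d L g Δ = 1 := by
  rw [rootWeight, rootWeightInv, orbitalMultiplier_mul, ← orbitalMultiplier_one]
  congr 1
  ext k
  exact mul_inv_cancel₀ (Real.sqrt_pos.2 (quasiDispersion_pos hg hΔ k)).ne'

/-- The deviation of `Γ = 1 - 2 γ` from the sign of the mean-field operator of `γ`. -/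
def signDefect (g Δ : ℝ) (γ : Matrix (Orbital d L) (Orbital d L) ℂ) :
    Matrix (Orbital d L) (Orbital d L) ℂ :=
  rootWeightInv d L g Δ * spinMeanField g (spinPart γ) - rootWeight d L g Δ * (1 - (2 : ℂ) • γ)

/-- The excess of the energy over `gapEnergy` is a sum of three terms, each nonnegative if
`0 ≤ γ ≤ 1`. The gap equation makes the terms quadratic in the spin density cancel. -/
theorem energy_eq_gapEnergy_add (hL : 3 ≤ L) {g Δ : ℝ} (hg : 0 < g) (hΔ : 0 < Δ)
    (hgap : GapEquation d L g Δ) {γ : Matrix (Orbital d L) (Orbital d L) ℂ} (hγ : γ.IsHermitian)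
    (htr : γ.trace = (Fintype.card (Lattice d L) : ℂ)) :
    energy g γ = gapEnergy d L g Δ + g / 4 * ∑ x, ((siteBlock γ x).trace.re - 1) ^ 2 +
      1 / 4 * ((signDefect g Δ γ).conjTranspose * signDefect g Δ γ).trace.re +
      1 / 4 * (rootWeight d L g Δ *
        (1 - (1 - (2 : ℂ) • γ) * (1 - (2 : ℂ) • γ)) * rootWeight d L g Δ).trace.re := by
  set B := spinPart γ with hBdef
  set A := spinMeanField g B with hAdef
  set Γ := 1 - (2 : ℂ) • γ with hΓdef
  have hA : A.IsHermitian := spinMeanField_isHermitian g (spinPart_isHermitian hγ)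
  have hΓ : Γ.IsHermitian := by
    rw [Matrix.IsHermitian, hΓdef, Matrix.conjTranspose_sub, Matrix.conjTranspose_smul, hγ.eq]
    simp
  have hsq := two_mul_trace_mul_eq hA hΓ (rootWeight_isHermitian g Δ)
    (rootWeightInv_isHermitian g Δ) (rootWeight_mul_rootWeightInv hg hΔ)
  rw [rootWeight_mul_self, rootWeightInv_mul_self, trace_orbitalMultiplier,
    trace_orbitalMultiplier_mul_spinMeanField_sq g _ (spinPart_trace γ)] at hsq
  have hAΓ : (A * Γ).trace = -(2 * (A * γ).trace) := by
    rw [hΓdef, Matrix.mul_sub, Matrix.mul_one, Matrix.mul_smul, Matrix.trace_sub,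
      Matrix.trace_smul, trace_spinMeanField hL g (spinPart_trace γ), smul_eq_mul, zero_sub]
  rw [hAΓ] at hsq
  have hre := congrArg Complex.re hsq
  have h2 : (2 * -(2 * (A * γ).trace)).re = -4 * (A * γ).trace.re := by
    simp
    ring
  -- By the gap equation, the diagonal of `M⁻¹` is `2 / g`.
  set q : ℝ := ∑ x, (B x * B x).trace.re with hq
  have h3 : ((g : ℂ) ^ 2 * (momentumAverage fun k : Lattice d L => (quasiDispersion g Δ k)⁻¹ : ℝ) *
      ∑ x, (B x * B x).trace).re = 2 * g * q := by
    have hgap' := (gapEquation_iff g Δ).1 hgap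
    rw [← Complex.ofReal_pow, ← Complex.ofReal_mul, Complex.re_ofReal_mul, Complex.re_sum, ← hq,
      sq, mul_assoc g, ← hgap']
    ring
  -- `T² M⁻¹ = M - g² Δ² M⁻¹`, and the trace of `M⁻¹` is given by the gap equation.
  have h4 : ∑ k : Lattice d L, (quasiDispersion g Δ k)⁻¹ * dispersion k ^ 2 =
      ∑ k : Lattice d L, quasiDispersion g Δ k -
        g * (Fintype.card (Lattice d L) : ℝ) * Δ ^ 2 * 2 := by
    have hgap' := (gapEquation_iff g Δ).1 hgap
    have hN : (Fintype.card (Lattice d L) : ℝ) ≠ 0 := Nat.cast_ne_zero.2 Fintype.card_ne_zero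
    have h5 : ∑ k : Lattice d L, (quasiDispersion g Δ k)⁻¹ =
        (Fintype.card (Lattice d L) : ℝ) *
          momentumAverage fun k : Lattice d L => (quasiDispersion g Δ k)⁻¹ := by
      rw [momentumAverage, mul_inv_cancel_left₀ hN]
    have h6 : ∀ k : Lattice d L, (quasiDispersion g Δ k)⁻¹ * dispersion k ^ 2 =
        quasiDispersion g Δ k - g ^ 2 * Δ ^ 2 * (quasiDispersion g Δ k)⁻¹ := by
      intro k
      have := (quasiDispersion_pos hg hΔ k).ne'
      have hs := quasiDispersion_sq g Δ k
      field_simp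
      linarith
    rw [Finset.sum_congr rfl fun k _ => h6 k, Finset.sum_sub_distrib, ← Finset.mul_sum, h5]
    linear_combination g * (Fintype.card (Lattice d L) : ℝ) * Δ ^ 2 * hgap'
  have h7 : ∑ x, ((siteBlock γ x).trace.re - 1) ^ 2 =
      ∑ x, (siteBlock γ x).trace.re ^ 2 - (Fintype.card (Lattice d L) : ℝ) := by
    have h8 : ∑ x, (siteBlock γ x).trace.re = (Fintype.card (Lattice d L) : ℝ) := by
      rw [← Complex.re_sum, sum_trace_siteBlock, htr, Complex.natCast_re]
    simp only [sub_sq, Finset.sum_add_distrib, Finset.sum_sub_distrib, mul_one, one_pow,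
      ← Finset.mul_sum, h8]
    simp
    ring
  rw [h2, Complex.sub_re, Complex.sub_re, Complex.add_re, Complex.add_re, h3] at hre
  simp only [h4] at hre
  rw [energy_eq_re_trace_spinMeanField hL g hγ, h7, gapEnergy, signDefect, ← hBdef, ← hAdef,
    ← hΓdef, ← hq]
  have h9 : ∀ r : ℝ, (2 * (r : ℂ)).re = 2 * r := fun r => by simp
  rw [h9, h9] at hre
  linarith

end

/-! ### Polar decomposition and density matrices -/

open scoped MatrixOrder in
/-- A positive semidefinite `M` with `M² = A²` is `|A|`, so that `A = M (1 - 2 · 1[A ≤ 0])` is the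
polar decomposition of `A`. -/
theorem eq_mul_one_sub_two_nonposProjection {ι : Type*} [Fintype ι] [DecidableEq ι]
    {A M : Matrix ι ι ℂ} (hA : A.IsHermitian) (hM : M.PosSemidef) (h : A * A = M * M) :
    A = M * (1 - (2 : ℂ) • nonposProjection A) := by
  have hcont : ∀ f : ℝ → ℝ, ContinuousOn f (spectrum ℝ A) := fun f =>
    A.finite_real_spectrum.continuousOn f
  have hsa : IsSelfAdjoint A := hA.isSelfAdjoint
  set s : ℝ → ℝ := fun t => if t ≤ 0 then -1 else 1 with hs
  have hS : 1 - (2 : ℂ) • nonposProjection A = cfc s A := by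
    have h1 : s = fun t => 1 - 2 * (if t ≤ 0 then (1 : ℝ) else 0) := by
      ext t
      by_cases ht : t ≤ 0 <;> norm_num [hs, ht]
    rw [h1, cfc_sub (fun _ => (1 : ℝ)) _ A (hcont _) (hcont _), cfc_const_one ℝ A,
      cfc_const_mul 2 _ A (hcont _), nonposProjection, ← Complex.coe_smul]
    norm_cast
  have hid : cfc (fun t : ℝ => t) A = A := cfc_id' ℝ A
  have habs : A * cfc s A = cfc (fun t : ℝ => |t|) A := by
    trans cfc (fun t : ℝ => t) A * cfc s A
    · rw [hid]
    rw [← cfc_mul _ _ A (hcont _) (hcont _)]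
    congr 1
    ext t
    by_cases ht : t ≤ 0
    · simp [hs, ht, abs_of_nonpos ht]
    · simp [hs, ht, abs_of_pos (not_le.1 ht)]
  have hss : cfc s A * cfc s A = 1 := by
    rw [← cfc_mul _ _ A (hcont _) (hcont _), ← cfc_const_one ℝ A]
    congr 1
    ext t
    by_cases ht : t ≤ 0 <;> simp [hs, ht]
  have hsq : cfc (fun t : ℝ => |t|) A * cfc (fun t : ℝ => |t|) A = M * M := by
    rw [← h, ← cfc_mul _ _ A (hcont _) (hcont _)]
    simp only [abs_mul_abs_self]
    rw [cfc_mul _ _ A (hcont _) (hcont _), hid]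
  have hMabs : cfc (fun t : ℝ => |t|) A = M :=
    (CFC.mul_self_eq_mul_self_iff _ _ (cfc_nonneg fun t _ => abs_nonneg t)
      (Matrix.nonneg_iff_posSemidef.2 hM)).1 hsq
  rw [hS, ← hMabs, ← habs, Matrix.mul_assoc, hss, Matrix.mul_one]

/-- `1 - Γ² = 4 γ (1 - γ)`, and `γ (1 - γ) = γ (1 - γ) γ + (1 - γ) γ (1 - γ)`. -/
theorem posSemidef_one_sub_sq {ι : Type*} [Fintype ι] [DecidableEq ι] {γ : Matrix ι ι ℂ}
    (h0 : γ.PosSemidef) (h1 : (1 - γ).PosSemidef) :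
    (1 - (1 - (2 : ℂ) • γ) * (1 - (2 : ℂ) • γ)).PosSemidef := by
  have e : 1 - (1 - (2 : ℂ) • γ) * (1 - (2 : ℂ) • γ) =
      (4 : ℝ) • (γ.conjTranspose * (1 - γ) * γ + (1 - γ).conjTranspose * γ * (1 - γ)) := by
    rw [h0.1.eq, h1.1.eq]
    have : (2 : ℂ) • γ = γ + γ := two_smul ℂ γ
    have h4 : ∀ X : Matrix ι ι ℂ, (4 : ℝ) • X = X + X + X + X := by
      intro X
      rw [show (4 : ℝ) = 1 + 1 + 1 + 1 by norm_num]
      simp only [add_smul, one_smul]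
    rw [this, h4]
    noncomm_ring
  rw [e]
  exact ((h1.conjTranspose_mul_mul_same γ).add (h0.conjTranspose_mul_mul_same (1 - γ))).smul
    (by norm_num)

/-! ### Pauli matrices -/

/-- A traceless Hermitian spin matrix is `v · σ` for a real vector `v`. -/
theorem exists_eq_pauliDot {B : Matrix (Fin 2) (Fin 2) ℂ} (hB : B.IsHermitian)
    (htr : B.trace = 0) : ∃ v : EuclideanSpace ℝ (Fin 3), B = pauliDot v := by
  refine ⟨!₂[(B 0 1).re, -(B 0 1).im, (B 0 0).re], ?_⟩
  have h00 : ((B 0 0).re : ℂ) = B 0 0 := Complex.conj_eq_iff_re.1 (congrFun (congrFun hB.eq 0) 0)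
  have h10 : B 1 0 = star (B 0 1) := (congrFun (congrFun hB.eq 1) 0).symm
  have h11 : B 1 1 = -B 0 0 := by
    rw [Matrix.trace_fin_two] at htr
    linear_combination htr
  ext i j
  fin_cases i <;> fin_cases j
  · simp [pauliDot, pauli, Fin.sum_univ_three, h00]
  · apply Complex.ext <;> simp [pauliDot, pauli, Fin.sum_univ_three]
  · apply Complex.ext <;> simp [pauliDot, pauli, Fin.sum_univ_three, h10]
  · simp [pauliDot, pauli, Fin.sum_univ_three, h00, h11]

theorem pauliDot_mul_self (v : EuclideanSpace ℝ (Fin 3)) :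
    pauliDot v * pauliDot v = ((‖v‖ : ℂ) ^ 2) • 1 := by
  have hv : (‖v‖ : ℂ) ^ 2 = (v 0 : ℂ) ^ 2 + (v 1 : ℂ) ^ 2 + (v 2 : ℂ) ^ 2 := by
    rw [← Complex.ofReal_pow, EuclideanSpace.real_norm_sq_eq, Fin.sum_univ_three]
    push_cast
    ring
  rw [hv]
  ext i j
  fin_cases i <;> fin_cases j <;>
    simp [pauliDot, pauli, Fin.sum_univ_three, Matrix.mul_apply, Fin.sum_univ_two] <;>
    ring_nf <;> simp

theorem pauliDot_smul (c : ℝ) (v : EuclideanSpace ℝ (Fin 3)) :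
    pauliDot (c • v) = (c : ℂ) • pauliDot v := by
  simp only [pauliDot, Finset.smul_sum, smul_smul, PiLp.smul_apply, smul_eq_mul,
    Complex.ofReal_mul]

theorem pauliDot_trace (v : EuclideanSpace ℝ (Fin 3)) : (pauliDot v).trace = 0 := by
  simp [pauliDot, pauli, Fin.sum_univ_three, Matrix.trace_fin_two]

/-! ### Staggered configurations -/

theorem staggerSign_mul_self (x : Lattice d L) : staggerSign x * staggerSign x = 1 := by
  rw [staggerSign, ← Finset.prod_mul_distrib]
  exact Finset.prod_eq_one fun ν _ => by rw [← mul_pow]; norm_num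

section

variable [NeZero L]

theorem staggerSign_add_single (h2 : 2 ∣ L) (x : Lattice d L) (ν : Fin d) :
    staggerSign (x + Pi.single ν 1) = -staggerSign x := by
  have hone : ∀ j : ZMod L, (-1 : ℂ) ^ (j + 1).val = -(-1) ^ j.val := by
    intro j
    have hmod : ∀ n : ℕ, (-1 : ℂ) ^ (n % L) = (-1) ^ n := by
      intro n
      conv_rhs => rw [← Nat.mod_add_div n L]
      rw [pow_add, pow_mul, (even_iff_two_dvd.2 h2).neg_one_pow, one_pow, mul_one]
    have h : (j + 1).val = (j.val + 1) % L := by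
      rw [← ZMod.val_natCast, Nat.cast_add, ZMod.natCast_zmod_val, Nat.cast_one]
    rw [h, hmod, pow_succ]
    ring
  have hrest : ∀ μ ∈ Finset.univ.erase ν,
      (-1 : ℂ) ^ ((x + Pi.single ν 1 : Lattice d L) μ).val = (-1) ^ (x μ).val := by
    intro μ hμ
    simp [Finset.ne_of_mem_erase hμ]
  rw [staggerSign, staggerSign, ← Finset.mul_prod_erase _ _ (Finset.mem_univ ν),
    ← Finset.mul_prod_erase _ _ (Finset.mem_univ ν), Finset.prod_congr rfl hrest, Pi.add_apply,
    Pi.single_eq_same, hone, neg_mul]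

/-- A function invariant under unit steps is constant: the torus is connected. -/
theorem apply_eq_apply_zero_of_add_single {α : Type*} {F : Lattice d L → α}
    (h : ∀ x ν, F (x + Pi.single ν 1) = F x) (x : Lattice d L) : F x = F 0 := by
  let S : AddSubmonoid (Lattice d L) :=
    { carrier := {a | ∀ y, F (y + a) = F y}
      zero_mem' := fun y => by rw [add_zero]
      add_mem' := fun {a b} ha hb y => by rw [← add_assoc, hb, ha] }
  have hS : ∀ y : Lattice d L, y ∈ S := by
    intro y
    have hy : y = ∑ ν, (y ν).val • Pi.single ν (1 : ZMod L) := by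
      conv_lhs => rw [← Finset.univ_sum_single y]
      refine Finset.sum_congr rfl fun ν _ => ?_
      rw [← Pi.single_smul, nsmul_eq_mul, ZMod.natCast_zmod_val, mul_one]
    rw [hy]
    exact S.sum_mem fun ν _ => S.nsmul_mem (fun x => h x ν) _
  have := hS x 0
  rwa [zero_add] at this

/-- The square of the mean-field operator equals `T² + g² Δ²` exactly if the linear terms and the
deviations of the spin squares from `Δ²` vanish blockwise. -/
theorem spinMeanField_mul_self_eq_iff (hL : 3 ≤ L) {g Δ : ℝ} (hg : g ≠ 0)
    (B : Lattice d L → Matrix (Fin 2) (Fin 2) ℂ) :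
    spinMeanField g B * spinMeanField g B =
        orbitalMultiplier (quasiDispersion g Δ) * orbitalMultiplier (quasiDispersion g Δ) ↔
      (∀ x, B x * B x = ((Δ : ℂ) ^ 2) • 1) ∧
        ∀ x y, (hopping (x - y) : ℂ) • (B x + B y) = 0 := by
  have hg' : (g : ℂ) ≠ 0 := Complex.ofReal_ne_zero.2 hg
  have hM : orbitalMultiplier (quasiDispersion g Δ) *
      orbitalMultiplier (quasiDispersion (d := d) (L := L) g Δ) =
      orbitalMultiplier (dispersion ^ 2) + ((g : ℂ) ^ 2 * (Δ : ℂ) ^ 2) • 1 := by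
    have hsq : quasiDispersion g Δ * quasiDispersion g Δ =
        fun k : Lattice d L => (dispersion ^ 2) k + g ^ 2 * Δ ^ 2 := by
      ext k
      rw [Pi.mul_apply, ← sq, quasiDispersion_sq, Pi.pow_apply]
    rw [orbitalMultiplier_mul, hsq, orbitalMultiplier, multiplier_add_const, Matrix.add_kronecker,
      Matrix.smul_kronecker, Matrix.one_kronecker_one, orbitalMultiplier]
    push_cast
    rfl
  have hT : ∀ x y, multiplier dispersion x y = (hopping (x - y : Lattice d L) : ℂ) := by
    intro x y
    rw [← hoppingMatrix_eq_multiplier hL]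
    rfl
  have hspin : ∀ (C : Lattice d L → Matrix (Fin 2) (Fin 2) ℂ) (p q : Orbital d L),
      spinField C p q = if p.1 = q.1 then C p.1 p.2 q.2 else 0 := fun _ _ _ => rfl
  have hentry : ∀ x σ y τ, (spinMeanField g B * spinMeanField g B -
      orbitalMultiplier (quasiDispersion g Δ) * orbitalMultiplier (quasiDispersion g Δ) :
        Matrix (Orbital d L) (Orbital d L) ℂ) (x, σ) (y, τ) =
      (g : ℂ) ^ 2 * (if x = y then (B x * B x - ((Δ : ℂ) ^ 2) • 1) σ τ else 0) -
        g * ((hopping (x - y) : ℂ) • (B x + B y)) σ τ := by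
    intro x σ y τ
    rw [hM, spinMeanField_mul_self]
    simp only [Matrix.sub_apply, Matrix.add_apply, Matrix.smul_apply, smul_eq_mul,
      orbitalMultiplier_mul_spinField, spinField_mul_orbitalMultiplier, hT, hspin,
      Matrix.one_apply, Prod.mk.injEq]
    by_cases hxy : x = y
    · simp only [hxy, true_and, if_true]
      ring
    · simp only [hxy, false_and, if_false]
      ring
  have hself : ∀ x : Lattice d L, hopping (x - x) = 0 := by
    intro x
    simp [hopping, torusNorm]
  rw [← sub_eq_zero]
  constructor
  · intro h
    refine ⟨fun x => ?_, fun x y => ?_⟩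
    · ext σ τ
      have := hentry x σ x τ
      rw [h, hself, if_pos rfl] at this
      simpa [hg', sub_eq_zero] using this
    · by_cases hxy : x = y
      · rw [hxy, hself, Complex.ofReal_zero, zero_smul]
      · ext σ τ
        have := hentry x σ y τ
        rw [h, if_neg hxy] at this
        simpa [hg'] using this
  · rintro ⟨h1, h2⟩
    ext ⟨x, σ⟩ ⟨y, τ⟩
    rw [hentry, h2 x y, h1 x]
    simp

/-- The staggered spin configuration, given by the spin matrices `(-1)^x Δ e · σ`. -/
def staggered (d L : ℕ) (Δ : ℝ) (e : EuclideanSpace ℝ (Fin 3)) (x : Lattice d L) :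
    Matrix (Fin 2) (Fin 2) ℂ :=
  staggerSign x • (Δ : ℂ) • pauliDot e

theorem spinMeanField_staggered (hL : 3 ≤ L) (g Δ : ℝ) (e : EuclideanSpace ℝ (Fin 3)) :
    spinMeanField g (staggered d L Δ e) = meanField d L (g * Δ) e := by
  rw [spinMeanField, meanField, orbitalMultiplier, hoppingMatrix_eq_multiplier hL]
  congr 1
  ext p q
  by_cases h : p.1 = q.1
  · simp [spinField, staggered, gauge, h]
    ring
  · simp [spinField, gauge, h]

/-- The spin field anticommutes with hopping exactly if the spins on neighbouring sites are
opposite. -/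
theorem hopping_smul_eq_zero_iff (hL : 3 ≤ L) {F : Lattice d L → Matrix (Fin 2) (Fin 2) ℂ} :
    (∀ x y, (hopping (x - y) : ℂ) • (F x + F y) = 0) ↔ ∀ x ν, F (x + Pi.single ν 1) = -F x := by
  constructor
  · intro h x ν
    have hn : hopping (x + Pi.single ν 1 - x : Lattice d L) = -1 := by
      rw [add_sub_cancel_left, hopping, if_pos ((torusNorm_eq_one_iff hL _).2 ⟨ν, Or.inl rfl⟩)]
    have := h (x + Pi.single ν 1) x
    rw [hn] at this
    rw [← add_eq_zero_iff_eq_neg]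
    rwa [Complex.ofReal_neg, Complex.ofReal_one, neg_smul, one_smul, neg_eq_zero] at this
  · intro h x y
    by_cases hn : torusNorm (x - y) = 1
    · obtain ⟨ν, hν | hν⟩ := (torusNorm_eq_one_iff hL _).1 hn
      · rw [sub_eq_iff_eq_add'.1 hν, h, neg_add_cancel, smul_zero]
      · have hy : y = x + Pi.single ν 1 := by
          rw [Pi.single_neg] at hν
          rw [← sub_eq_iff_eq_add', ← neg_sub, hν, neg_neg]
        rw [hy, h, add_neg_cancel, smul_zero]
    · simp [hopping, hn]

/-- Staggered configurations meet the conditions of `spinMeanField_mul_self_eq_iff`. -/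
theorem staggered_mul_self_and_hopping (hL : 3 ≤ L) (h2 : 2 ∣ L) (Δ : ℝ)
    {e : EuclideanSpace ℝ (Fin 3)} (he : ‖e‖ = 1) :
    (∀ x, staggered d L Δ e x * staggered d L Δ e x = ((Δ : ℂ) ^ 2) • 1) ∧
      ∀ x y, (hopping (x - y) : ℂ) • (staggered d L Δ e x + staggered d L Δ e y) = 0 := by
  refine ⟨fun x => ?_, (hopping_smul_eq_zero_iff hL).2 fun x ν => ?_⟩
  · simp only [staggered, Matrix.smul_mul, Matrix.mul_smul, pauliDot_mul_self, he, smul_smul]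
    congr 1
    rw [Complex.ofReal_one]
    linear_combination (Δ : ℂ) ^ 2 * staggerSign_mul_self x
  · rw [staggered, staggerSign_add_single h2, neg_smul, staggered]

/-- Spins of constant length that alternate along every bond form a staggered configuration. -/
theorem exists_eq_staggered (hL : 3 ≤ L) (h2 : 2 ∣ L) {Δ : ℝ} (hΔ : 0 < Δ)
    {B : Lattice d L → Matrix (Fin 2) (Fin 2) ℂ} (hB : (B 0).IsHermitian)
    (htr : (B 0).trace = 0) (hsq : B 0 * B 0 = ((Δ : ℂ) ^ 2) • 1)
    (hhop : ∀ x y, (hopping (x - y) : ℂ) • (B x + B y) = 0) :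
    ∃ e : EuclideanSpace ℝ (Fin 3), ‖e‖ = 1 ∧ B = staggered d L Δ e := by
  obtain ⟨v, hv⟩ := exists_eq_pauliDot hB htr
  have hnorm : ‖v‖ = Δ := by
    rw [hv, pauliDot_mul_self] at hsq
    have h := congrFun (congrFun hsq 0) 0
    simp only [Matrix.smul_apply, Matrix.one_apply_eq, smul_eq_mul, mul_one] at h
    norm_cast at h
    exact (pow_left_inj₀ (norm_nonneg v) hΔ.le two_ne_zero).1 h
  refine ⟨Δ⁻¹ • v, ?_, ?_⟩
  · rw [norm_smul, hnorm, norm_inv, Real.norm_of_nonneg hΔ.le, inv_mul_cancel₀ hΔ.ne']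
  · have hconst := apply_eq_apply_zero_of_add_single (F := fun x => staggerSign x • B x)
      fun x ν => by
      rw [staggerSign_add_single h2, (hopping_smul_eq_zero_iff hL).1 hhop, neg_smul_neg]
    ext1 x
    have hx := hconst x
    have h0 : staggerSign (0 : Lattice d L) = 1 := by simp [staggerSign]
    simp only [h0, one_smul] at hx
    have hΔ' : (Δ : ℂ) ≠ 0 := Complex.ofReal_ne_zero.2 hΔ.ne'
    rw [staggered, pauliDot_smul, smul_smul (Δ : ℂ), Complex.ofReal_inv,
      mul_inv_cancel₀ hΔ', one_smul, ← hv, ← hx, smul_smul, staggerSign_mul_self, one_smul]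

end

/-! ### The lower bound and its equality case -/

section

variable [NeZero L]

theorem orbitalMultiplier_quasiDispersion_posSemidef (g Δ : ℝ) :
    (orbitalMultiplier (quasiDispersion (d := d) (L := L) g Δ)).PosSemidef := by
  rw [← rootWeight_mul_self]
  conv =>
    enter [1, 1]
    rw [← (rootWeight_isHermitian g Δ).eq]
  exact Matrix.posSemidef_conjTranspose_mul_self _

theorem inv_mul_orbitalMultiplier_quasiDispersion {g Δ : ℝ} (hg : 0 < g) (hΔ : 0 < Δ) :
    (orbitalMultiplier fun k : Lattice d L => (quasiDispersion g Δ k)⁻¹) *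
      orbitalMultiplier (quasiDispersion g Δ) = 1 := by
  rw [orbitalMultiplier_mul, ← orbitalMultiplier_one]
  congr 1
  ext k
  exact inv_mul_cancel₀ (quasiDispersion_pos hg hΔ k).ne'

theorem rootWeight_conj_posSemidef {g Δ : ℝ} {Q : Matrix (Orbital d L) (Orbital d L) ℂ}
    (hQ : Q.PosSemidef) : (rootWeight d L g Δ * Q * rootWeight d L g Δ).PosSemidef := by
  have h := hQ.conjTranspose_mul_mul_same (rootWeight d L g Δ)
  rwa [(rootWeight_isHermitian g Δ).eq] at h

variable {g Δ : ℝ} {γ : Matrix (Orbital d L) (Orbital d L) ℂ}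

theorem gapEnergy_le_energy (hL : 3 ≤ L) (hg : 0 < g) (hΔ : 0 < Δ) (hgap : GapEquation d L g Δ)
    (hγ : IsDensityMatrix (Fintype.card (Lattice d L)) γ) : gapEnergy d L g Δ ≤ energy g γ := by
  rw [energy_eq_gapEnergy_add hL hg hΔ hgap hγ.nonneg.1 hγ.trace_eq]
  have h1 : 0 ≤ g / 4 * ∑ x, ((siteBlock γ x).trace.re - 1) ^ 2 := by positivity
  have h2 := (Complex.le_def.1
    (Matrix.posSemidef_conjTranspose_mul_self (signDefect g Δ γ)).trace_nonneg).1
  have h3 := (Complex.le_def.1 (rootWeight_conj_posSemidef (g := g) (Δ := Δ)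
    (posSemidef_one_sub_sq hγ.nonneg hγ.le_one)).trace_nonneg).1
  rw [Complex.zero_re] at h2 h3
  linarith

/-- If the lower bound is attained then `Γ = 1 - 2 γ` is the sign of the mean-field operator `A` of
`γ`: with the weight `M = (T² + g² Δ²)^{1/2}`, `A = M Γ` and `Γ² = 1`. -/
theorem spinMeanField_eq_of_energy_eq (hL : 3 ≤ L) (hg : 0 < g) (hΔ : 0 < Δ)
    (hgap : GapEquation d L g Δ) (hγ : IsDensityMatrix (Fintype.card (Lattice d L)) γ)
    (hE : energy g γ = gapEnergy d L g Δ) :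
    spinMeanField g (spinPart γ) =
        orbitalMultiplier (quasiDispersion g Δ) * (1 - (2 : ℂ) • γ) ∧
      (1 - (2 : ℂ) • γ) * (1 - (2 : ℂ) • γ) = 1 := by
  rw [energy_eq_gapEnergy_add hL hg hΔ hgap hγ.nonneg.1 hγ.trace_eq] at hE
  have h1 : 0 ≤ g / 4 * ∑ x, ((siteBlock γ x).trace.re - 1) ^ 2 := by positivity
  have h2 := Complex.le_def.1
    (Matrix.posSemidef_conjTranspose_mul_self (signDefect g Δ γ)).trace_nonneg
  have hQ := rootWeight_conj_posSemidef (g := g) (Δ := Δ)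
    (posSemidef_one_sub_sq hγ.nonneg hγ.le_one)
  have h3 := Complex.le_def.1 hQ.trace_nonneg
  rw [Complex.zero_re] at h2 h3
  have hRS := rootWeight_mul_rootWeightInv (d := d) (L := L) hg hΔ
  constructor
  · have h4 : ((signDefect g Δ γ).conjTranspose * signDefect g Δ γ).trace = 0 := by
      refine Complex.ext ?_ h2.2.symm
      rw [Complex.zero_re]
      linarith [h2.1, h3.1]
    have h5 := Matrix.trace_conjTranspose_mul_self_eq_zero_iff.1 h4
    rw [signDefect, sub_eq_zero] at h5
    have h6 := congrArg (rootWeight d L g Δ * ·) h5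
    simp only [← Matrix.mul_assoc, hRS, rootWeight_mul_self, Matrix.one_mul] at h6
    exact h6
  · set Q := 1 - (1 - (2 : ℂ) • γ) * (1 - (2 : ℂ) • γ) with hQdef
    have h4 : (rootWeight d L g Δ * Q * rootWeight d L g Δ).trace = 0 := by
      refine Complex.ext ?_ h3.2.symm
      rw [Complex.zero_re]
      linarith [h2.1, h3.1]
    have h5 := hQ.trace_eq_zero_iff.1 h4
    have h6 : rootWeightInv d L g Δ * (rootWeight d L g Δ * Q * rootWeight d L g Δ) *
        rootWeightInv d L g Δ = Q := by
      rw [Matrix.mul_assoc, Matrix.mul_assoc, hRS, Matrix.mul_one, ← Matrix.mul_assoc,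
        mul_eq_one_comm.1 hRS, Matrix.one_mul]
    rw [h5, Matrix.mul_zero, Matrix.zero_mul] at h6
    exact (sub_eq_zero.1 h6.symm).symm

/-- Polar decomposition of the staggered mean-field operator: its absolute value is
`(T² + g² Δ²)^{1/2}`. -/
theorem meanField_eq_mul (hL : 3 ≤ L) (h2 : 2 ∣ L) (hg : 0 < g)
    {e : EuclideanSpace ℝ (Fin 3)} (he : ‖e‖ = 1) :
    meanField d L (g * Δ) e = orbitalMultiplier (quasiDispersion g Δ) *
      (1 - (2 : ℂ) • nonposProjection (meanField d L (g * Δ) e)) := by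
  refine eq_mul_one_sub_two_nonposProjection (meanField_isHermitian d L _ e)
    (orbitalMultiplier_quasiDispersion_posSemidef g Δ) ?_
  rw [← spinMeanField_staggered hL]
  exact (spinMeanField_mul_self_eq_iff hL hg.ne' _).2 (staggered_mul_self_and_hopping hL h2 Δ he)

/-- A state attaining the lower bound has a mean-field operator with square `T² + g² Δ²`, hence a
staggered spin density. -/
theorem exists_eq_nonposProjection_of_energy_eq (hL : 3 ≤ L) (h2 : 2 ∣ L) (hg : 0 < g) (hΔ : 0 < Δ)
    (hgap : GapEquation d L g Δ) (hγ : IsDensityMatrix (Fintype.card (Lattice d L)) γ)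
    (hE : energy g γ = gapEnergy d L g Δ) :
    ∃ e : EuclideanSpace ℝ (Fin 3), ‖e‖ = 1 ∧
      γ = nonposProjection (meanField d L (g * Δ) e) := by
  obtain ⟨hA, hΓ⟩ := spinMeanField_eq_of_energy_eq hL hg hΔ hgap hγ hE
  have hherm := hγ.nonneg.1
  have hΓH : (1 - (2 : ℂ) • γ).conjTranspose = 1 - (2 : ℂ) • γ := by
    rw [Matrix.conjTranspose_sub, Matrix.conjTranspose_smul, hherm.eq]
    simp
  have hAA : spinMeanField g (spinPart γ) * spinMeanField g (spinPart γ) =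
      orbitalMultiplier (quasiDispersion g Δ) * orbitalMultiplier (quasiDispersion g Δ) := by
    have hAH := (spinMeanField_isHermitian g (spinPart_isHermitian hherm)).eq
    conv_lhs =>
      enter [2]
      rw [← hAH]
    rw [hA, Matrix.conjTranspose_mul, hΓH, (orbitalMultiplier_isHermitian _).eq, Matrix.mul_assoc,
      ← Matrix.mul_assoc (1 - (2 : ℂ) • γ), hΓ, Matrix.one_mul]
  -- The block comparison of `A² = M²` determines the spin density up to a global rotation.
  obtain ⟨hsq, hhop⟩ := (spinMeanField_mul_self_eq_iff hL hg.ne' _).1 hAA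
  obtain ⟨e, he, hB⟩ := exists_eq_staggered hL h2 hΔ (spinPart_isHermitian hherm 0)
    (spinPart_trace γ 0) (hsq 0) hhop
  refine ⟨e, he, ?_⟩
  rw [hB, spinMeanField_staggered hL, meanField_eq_mul hL h2 hg he] at hA
  have h := congrArg ((orbitalMultiplier fun k => (quasiDispersion g Δ k)⁻¹) * ·) hA
  simp only [← Matrix.mul_assoc, inv_mul_orbitalMultiplier_quasiDispersion hg hΔ,
    Matrix.one_mul] at h
  exact (smul_right_injective _ (two_ne_zero (α := ℂ)) (sub_right_injective h)).symm

/-! ### The staggered states attain the lower bound -/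

theorem nonposProjection_isHermitian {ι : Type*} [Fintype ι] [DecidableEq ι] (A : Matrix ι ι ℂ) :
    (nonposProjection A).IsHermitian :=
  cfc_predicate (p := IsSelfAdjoint) _ A

theorem one_sub_two_nonposProjection_meanField_eq (hL : 3 ≤ L) (h2 : 2 ∣ L) (hg : 0 < g)
    (hΔ : 0 < Δ) {e : EuclideanSpace ℝ (Fin 3)} (he : ‖e‖ = 1) :
    1 - (2 : ℂ) • nonposProjection (meanField d L (g * Δ) e) =
      (orbitalMultiplier fun k => (quasiDispersion g Δ k)⁻¹) * meanField d L (g * Δ) e := by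
  conv_rhs => rw [meanField_eq_mul hL h2 hg he]
  rw [← Matrix.mul_assoc, inv_mul_orbitalMultiplier_quasiDispersion hg hΔ, Matrix.one_mul]

theorem one_sub_two_nonposProjection_mul_self (hL : 3 ≤ L) (h2 : 2 ∣ L) (hg : 0 < g)
    (hΔ : 0 < Δ) {e : EuclideanSpace ℝ (Fin 3)} (he : ‖e‖ = 1) :
    (1 - (2 : ℂ) • nonposProjection (meanField d L (g * Δ) e)) *
      (1 - (2 : ℂ) • nonposProjection (meanField d L (g * Δ) e)) = 1 := by
  set Γ := 1 - (2 : ℂ) • nonposProjection (meanField d L (g * Δ) e) with hΓ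
  have hΓH : Γ.conjTranspose = Γ := by
    rw [hΓ, Matrix.conjTranspose_sub, Matrix.conjTranspose_smul,
      (nonposProjection_isHermitian _).eq]
    simp
  have hinv := inv_mul_orbitalMultiplier_quasiDispersion (d := d) (L := L) hg hΔ
  have h1 : Γ = (orbitalMultiplier fun k => (quasiDispersion g Δ k)⁻¹) *
      meanField d L (g * Δ) e := one_sub_two_nonposProjection_meanField_eq hL h2 hg hΔ he
  have hsq : meanField d L (g * Δ) e * meanField d L (g * Δ) e =
      orbitalMultiplier (quasiDispersion g Δ) * orbitalMultiplier (quasiDispersion g Δ) := by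
    rw [← spinMeanField_staggered hL]
    exact (spinMeanField_mul_self_eq_iff hL hg.ne' _).2 (staggered_mul_self_and_hopping hL h2 Δ he)
  conv_lhs =>
    enter [2]
    rw [← hΓH]
  rw [h1, Matrix.conjTranspose_mul, (orbitalMultiplier_isHermitian _).eq,
    (meanField_isHermitian d L _ e).eq, Matrix.mul_assoc, ← Matrix.mul_assoc (meanField _ _ _ _),
    hsq, Matrix.mul_assoc, mul_eq_one_comm.1 hinv, Matrix.mul_one, hinv]

/-- The self-consistency of the staggered state: its on-site blocks are `1/2 + (-1)^x Δ e · σ`. The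
charge term is `1/2` because `ω_ξ` is odd under `ξ ↦ ξ + (π, …, π)`, the spin term is the gap
equation. -/
theorem siteBlock_nonposProjection_meanField (hL : 3 ≤ L) (h2 : 2 ∣ L) (hg : 0 < g)
    (hΔ : 0 < Δ) (hgap : GapEquation d L g Δ) {e : EuclideanSpace ℝ (Fin 3)} (he : ‖e‖ = 1)
    (x : Lattice d L) :
    siteBlock (nonposProjection (meanField d L (g * Δ) e)) x =
      (1 / 2 : ℂ) • 1 + staggered d L Δ e x := by
  have h := one_sub_two_nonposProjection_meanField_eq (d := d) hL h2 hg hΔ he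
  have hA : (orbitalMultiplier fun k => (quasiDispersion g Δ k)⁻¹) * meanField d L (g * Δ) e =
      orbitalMultiplier ((fun k => (quasiDispersion g Δ k)⁻¹) * dispersion) -
        (g : ℂ) • ((orbitalMultiplier fun k => (quasiDispersion g Δ k)⁻¹) *
          spinField (staggered d L Δ e)) := by
    rw [← spinMeanField_staggered hL, spinMeanField, Matrix.mul_sub, Matrix.mul_smul,
      orbitalMultiplier_mul]
  rw [hA] at h
  have hodd : momentumAverage ((fun k : Lattice d L => (quasiDispersion g Δ k)⁻¹) * dispersion) =
      0 := by
    refine momentumAverage_eq_zero_of_add_eq_neg (fun _ => ((L / 2 : ℕ) : ZMod L)) fun k => ?_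
    simp only [Pi.mul_apply, quasiDispersion, dispersion_add_half hL h2, neg_sq, mul_neg]
  have hgap' : (2 : ℂ) = g *
      (momentumAverage fun k : Lattice d L => (quasiDispersion g Δ k)⁻¹ : ℝ) := by
    exact_mod_cast (gapEquation_iff g Δ).1 hgap
  ext σ τ
  have hστ := congrFun (congrFun h (x, σ)) (x, τ)
  rw [Matrix.sub_apply, Matrix.sub_apply, Matrix.smul_apply, Matrix.smul_apply,
    orbitalMultiplier_mul_spinField, multiplier_apply_self, orbitalMultiplier,
    Matrix.kronecker_apply, multiplier_apply_self, hodd] at hστ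
  have hone : (1 : Matrix (Orbital d L) (Orbital d L) ℂ) (x, σ) (x, τ) =
      (1 : Matrix (Fin 2) (Fin 2) ℂ) σ τ := by
    simp [Matrix.one_apply]
  rw [hone] at hστ
  simp only [smul_eq_mul, Complex.ofReal_zero, zero_mul, zero_sub, ← mul_assoc, ← hgap'] at hστ
  rw [siteBlock, Matrix.of_apply, Matrix.add_apply, Matrix.smul_apply, smul_eq_mul]
  linear_combination (-1 / 2 : ℂ) * hστ

theorem isDensityMatrix_nonposProjection_meanField (hL : 3 ≤ L) (h2 : 2 ∣ L) (hg : 0 < g)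
    (hΔ : 0 < Δ) (hgap : GapEquation d L g Δ) {e : EuclideanSpace ℝ (Fin 3)} (he : ‖e‖ = 1) :
    IsDensityMatrix (Fintype.card (Lattice d L)) (nonposProjection (meanField d L (g * Δ) e)) := by
  have hsq := one_sub_two_nonposProjection_mul_self (d := d) hL h2 hg hΔ he
  have hblock := siteBlock_nonposProjection_meanField (d := d) hL h2 hg hΔ hgap he
  have hH := nonposProjection_isHermitian (meanField d L (g * Δ) e)
  set γ := nonposProjection (meanField d L (g * Δ) e)
  have hγ : γ * γ = γ := by
    have h4 : (4 : ℂ) • (γ * γ) = (4 : ℂ) • γ := by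
      simp only [Matrix.sub_mul, Matrix.mul_sub, Matrix.one_mul, Matrix.mul_one, Matrix.smul_mul,
        Matrix.mul_smul] at hsq
      have : (4 : ℂ) • (γ * γ) - (4 : ℂ) • γ =
          (1 - (2 : ℂ) • γ - (2 : ℂ) • (γ - (2 : ℂ) • (γ * γ))) - 1 := by
        module
      rw [← sub_eq_zero, this, hsq, sub_self]
    exact smul_right_injective _ (four_ne_zero (α := ℂ)) h4
  have h1H : (1 - γ).conjTranspose = 1 - γ := by
    rw [Matrix.conjTranspose_sub, Matrix.conjTranspose_one, hH.eq]
  refine ⟨?_, ?_, ?_⟩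
  · have := Matrix.posSemidef_conjTranspose_mul_self γ
    rwa [hH.eq, hγ] at this
  · have := Matrix.posSemidef_conjTranspose_mul_self (1 - γ)
    rwa [h1H, Matrix.sub_mul, Matrix.mul_sub, Matrix.mul_sub, hγ, Matrix.one_mul, Matrix.one_mul,
      Matrix.mul_one, sub_self, sub_zero] at this
  · rw [← sum_trace_siteBlock]
    simp [hblock, staggered, pauliDot_trace]

/-- All three terms of `energy_eq_gapEnergy_add` vanish for the staggered states. -/
theorem energy_nonposProjection_meanField (hL : 3 ≤ L) (h2 : 2 ∣ L) (hg : 0 < g)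
    (hΔ : 0 < Δ) (hgap : GapEquation d L g Δ) {e : EuclideanSpace ℝ (Fin 3)} (he : ‖e‖ = 1) :
    energy g (nonposProjection (meanField d L (g * Δ) e)) = gapEnergy d L g Δ := by
  have hD := isDensityMatrix_nonposProjection_meanField (d := d) hL h2 hg hΔ hgap he
  have htrace : ∀ x, (siteBlock (nonposProjection (meanField d L (g * Δ) e)) x).trace = 1 := by
    intro x
    rw [siteBlock_nonposProjection_meanField hL h2 hg hΔ hgap he]
    simp [staggered, pauliDot_trace]
  have hspin : spinPart (nonposProjection (meanField d L (g * Δ) e)) = staggered d L Δ e := by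
    ext1 x
    rw [spinPart, htrace, siteBlock_nonposProjection_meanField hL h2 hg hΔ hgap he,
      add_sub_cancel_left]
  have hsq := one_sub_two_nonposProjection_mul_self (d := d) hL h2 hg hΔ he
  have hpolar := meanField_eq_mul (d := d) (Δ := Δ) hL h2 hg he
  generalize nonposProjection (meanField d L (g * Δ) e) = γ at *
  have hinv : rootWeightInv d L g Δ * rootWeight d L g Δ = 1 :=
    mul_eq_one_comm.1 (rootWeight_mul_rootWeightInv hg hΔ)
  have hdef : signDefect g Δ γ = 0 := by
    rw [signDefect, hspin, spinMeanField_staggered hL, hpolar, ← rootWeight_mul_self,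
      ← Matrix.mul_assoc, ← Matrix.mul_assoc, hinv, Matrix.one_mul, sub_self]
  rw [energy_eq_gapEnergy_add hL hg hΔ hgap hD.nonneg.1 hD.trace_eq, hsq, hdef]
  simp [htrace]

theorem hfEnergy_eq_gapEnergy (hL : 3 ≤ L) (h2 : 2 ∣ L) (hg : 0 < g) (hΔ : 0 < Δ)
    (hgap : GapEquation d L g Δ) :
    hfEnergy d L g (Fintype.card (Lattice d L)) = gapEnergy d L g Δ := by
  refine IsLeast.csInf_eq ⟨?_, ?_⟩
  · have he : ‖EuclideanSpace.single (0 : Fin 3) (1 : ℝ)‖ = 1 := by simp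
    exact ⟨_, isDensityMatrix_nonposProjection_meanField hL h2 hg hΔ hgap he,
      energy_nonposProjection_meanField hL h2 hg hΔ hgap he⟩
  · rintro _ ⟨γ, hγ, rfl⟩
    exact gapEnergy_le_energy hL hg hΔ hgap hγ

end

end Hubbard

end

theorem mainTheorem4 (d L : ℕ) [NeZero L] (hd : 0 < d) (hL : 4 ∣ L) (g : ℝ) (hg : 0 < g) :
    ∃ Δ : ℝ, (0 < Δ ∧ Δ < 1 / 2) ∧ Hubbard.GapEquation d L g Δ ∧
      (∀ Δ' : ℝ, 0 < Δ' → Hubbard.GapEquation d L g Δ' → Δ' = Δ) ∧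
      Hubbard.hfEnergy d L g (Fintype.card (Hubbard.Lattice d L)) /
          (Fintype.card (Hubbard.Lattice d L) : ℝ) =
        g / 4 + g * Δ ^ 2 -
          Hubbard.momentumAverage (fun k : Hubbard.Lattice d L =>
            √(Hubbard.dispersion k ^ 2 + g ^ 2 * Δ ^ 2)) ∧
      ∀ γ : Matrix (Hubbard.Orbital d L) (Hubbard.Orbital d L) ℂ,
        Hubbard.IsDensityMatrix (Fintype.card (Hubbard.Lattice d L)) γ →
        (Hubbard.IsHFGroundState g (Fintype.card (Hubbard.Lattice d L)) γ ↔
          ∃ e : EuclideanSpace ℝ (Fin 3), ‖e‖ = 1 ∧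
            γ = Hubbard.nonposProjection (Hubbard.meanField d L (g * Δ) e)) := by
  have hL3 : 3 ≤ L := le_trans (by norm_num) (Nat.le_of_dvd (Nat.pos_of_ne_zero (NeZero.ne L)) hL)
  have h2 : 2 ∣ L := dvd_trans (by norm_num) hL
  obtain ⟨Δ, hΔ, hgap, huniq⟩ := Hubbard.exists_gapEquation hd hL hg
  have hE := Hubbard.hfEnergy_eq_gapEnergy hL3 h2 hg hΔ.1 hgap
  refine ⟨Δ, hΔ, hgap, huniq, ?_, fun γ hγ => ⟨fun h => ?_, ?_⟩⟩
  · have hN : (Fintype.card (Hubbard.Lattice d L) : ℝ) ≠ 0 :=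
      Nat.cast_ne_zero.2 Fintype.card_ne_zero
    rw [hE, Hubbard.gapEnergy, sub_div, mul_div_cancel_left₀ _ hN,
      div_eq_inv_mul (∑ k, _)]
    rfl
  · exact Hubbard.exists_eq_nonposProjection_of_energy_eq hL3 h2 hg hΔ.1 hgap hγ (h.2.trans hE)
  · rintro ⟨e, he, rfl⟩
    exact ⟨hγ, (Hubbard.energy_nonposProjection_meanField hL3 h2 hg hΔ.1 hgap he).trans hE.symm⟩
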